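/- Let $R$ be a commutative Noetherian ring and $\Gamma$ a Noetherian $R$-algebra (an associative unital $R$-algebra, finitely generated as an $R$-module). Let $M$ be a finitely generated $\Gamma$-bimodule on which $R$ acts centrally, and suppose $M^{\otimes n}=M\otimes_\Gamma\cdots\otimes_\Gamma M=0$ ($n$ factors) for some integer $n\ge 1$. Let $\Gamma\ltimes M=\Gamma\oplus M$ be the trivial extension, with multiplication $(\gamma,m)(\gamma',m')=(\gamma\gamma',\gamma m'+m\gamma')$. For a Noetherian algebra $\Lambda$ let $\mathrm{mod}\text{-}\Lambda$ be the abelian category of finitely generated right $\Lambda$-modules. For an object or class $\mathcal U$, $\mathrm{add}(\mathcal U)$ denotes the class of direct summands of finite direct sums of copies of (objects of) $\mathcal U$. * $\mathrm{IT}(\Lambda)$ is the infimum of the $m\ge 0$ for which there are $t\ge 0$ and $U\in\mathrm{mod}\text{-}\Lambda$ such that for every $X\in\mathrm{mod}\text{-}\Lambda$ there is an exact sequence $0\to U_m\to\cdots\to U_0\to\Omega^t(X)\to 0$ with all $U_i\in\mathrm{add}(U)$, where $\Omega^t(X)$ is a $t$-th syzygy of $X$. * $\dim\Lambda$ is the infimum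 of the $m\ge 0$ for which there is $T\in\mathrm{mod}\text{-}\Lambda$ with $\mathrm{mod}\text{-}\Lambda=[T]_{m+1}$. Here $[T]_1=\mathrm{add}(T)$, and $[T]_{k+1}$ is $\mathrm{add}$ of the class of the $A$ admitting an exact sequence $0\to U\to A\to V\to 0$ with $U\in[T]_1$, $V\in[T]_k$. * $\mathrm{der.dim}\,\mathbf D^b(\mathrm{mod}\text{-}\Lambda)$ is the Rouquier dimension of the bounded derived category: the infimum of the $m\ge 0$ for which $\mathbf D^b(\mathrm{mod}\text{-}\Lambda)=\langle T\rangle_{m+1}$ for some object $T$. Here $\langle T\rangle_1$ is the closure of $T$ under shifts, finite direct sums and direct summands, and $\langle T\rangle_{k+1}$ is the same closure of the class of the $A$ in triangles $U\to A\to V\to U[1]$ with $U\in\langle T\rangle_1$, $V\in\langle T\rangle_k$. All three take values in $\mathbb N\cup\{\infty\}$, an infimum over the empty set being $\infty$. Then: 1. If ${}_\Gamma M$ and $M_\Gamma$ are projective, then $\mathrm{IT}(\Gamma)\le\mathrm{IT}(\Gamma\ltimes M)\le n(\mathrm{IT}(\Gamma)+1)-1$. 2. If $M_\Gamma$ is projective,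 then $\dim\Gamma\le\dim(\Gamma\ltimes M)\le n(\dim\Gamma+1)-1$. 3. If $M$ is left perfect, that is, the left module ${}_\Gamma M$ has finite projective dimension and $\mathrm{Tor}_i^\Gamma(M,M^{\otimes j})=0$ for all $i,j\ge 1$, then $$\mathrm{der.dim}\,\mathbf D^b(\mathrm{mod}\text{-}\Gamma)\le\mathrm{der.dim}\,\mathbf D^b(\mathrm{mod}\text{-}\Gamma\ltimes M)\le n\bigl(\mathrm{der.dim}\,\mathbf D^b(\mathrm{mod}\text{-}\Gamma)+1\bigr)-1.$$ -/

import Mathlib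

open CategoryTheory CategoryTheory.Limits
open scoped TensorProduct

universe w v u

namespace CleftDim

/-! ### Tensor products over a noncommutative ring, tensor powers of bimodules, `Tor` -/

section Tensor

variable (Γ : Type u) [Ring Γ]

/-- The subgroup of `X ⊗_ℤ Y` generated by the elements `xγ ⊗ y - x ⊗ γy`. -/
def balancedRelations (X Y : Type u) [AddCommGroup X] [Module Γᵐᵒᵖ X] [AddCommGroup Y]
    [Module Γ Y] : AddSubgroup (X ⊗[ℤ] Y) :=
  AddSubgroup.closure {z | ∃ (x : X) (γ : Γ) (y : Y),
    z = (MulOpposite.op γ • x) ⊗ₜ[ℤ] y - x ⊗ₜ[ℤ] (γ • y)}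

/-- The tensor product `X ⊗_Γ Y` of a right `Γ`-module `X` and a left `Γ`-module `Y`, over an
arbitrary ring `Γ`. Right `Γ`-modules are `Γᵐᵒᵖ`-modules, with `xγ = op γ • x`. -/
def NCTensor (X Y : Type u) [AddCommGroup X] [Module Γᵐᵒᵖ X] [AddCommGroup Y]
    [Module Γ Y] : Type u :=
  (X ⊗[ℤ] Y) ⧸ balancedRelations Γ X Y

instance (X Y : Type u) [AddCommGroup X] [Module Γᵐᵒᵖ X] [AddCommGroup Y]
    [Module Γ Y] : AddCommGroup (NCTensor Γ X Y) :=
  inferInstanceAs (AddCommGroup ((X ⊗[ℤ] Y) ⧸ balancedRelations Γ X Y))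

variable {Γ}
variable {X Y X' Y' : Type u}
  [AddCommGroup X] [Module Γᵐᵒᵖ X] [AddCommGroup Y] [Module Γ Y]
  [AddCommGroup X'] [Module Γᵐᵒᵖ X'] [AddCommGroup Y'] [Module Γ Y']

/-- The class of `x ⊗ y` in `X ⊗_Γ Y`. -/
def NCTensor.tmul (x : X) (y : Y) : NCTensor Γ X Y :=
  QuotientAddGroup.mk' (balancedRelations Γ X Y) (x ⊗ₜ[ℤ] y)

/-- Functoriality of the tensor product: `f ⊗ g : X ⊗_Γ Y → X' ⊗_Γ Y'`. -/
noncomputable def NCTensor.map (f : X →ₗ[Γᵐᵒᵖ] X') (g : Y →ₗ[Γ] Y') :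
    NCTensor Γ X Y →+ NCTensor Γ X' Y' :=
  QuotientAddGroup.map (balancedRelations Γ X Y) (balancedRelations Γ X' Y')
    (TensorProduct.map f.toAddMonoidHom.toIntLinearMap
      g.toAddMonoidHom.toIntLinearMap).toAddMonoidHom (by
      refine (AddSubgroup.closure_le _).2 ?_
      rintro _ ⟨x, γ, y, rfl⟩
      refine AddSubgroup.subset_closure ⟨f x, γ, g y, ?_⟩
      refine (map_sub _ _ _).trans ?_
      change f (MulOpposite.op γ • x) ⊗ₜ[ℤ] g y - f x ⊗ₜ[ℤ] g (γ • y) = _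
      rw [map_smul, map_smul])

@[simp]
theorem NCTensor.map_tmul (f : X →ₗ[Γᵐᵒᵖ] X') (g : Y →ₗ[Γ] Y') (x : X) (y : Y) :
    NCTensor.map f g (NCTensor.tmul x y) = NCTensor.tmul (f x) (g y) := rfl

theorem NCTensor.tmul_add (x : X) (y y' : Y) :
    (NCTensor.tmul x (y + y') : NCTensor Γ X Y) = NCTensor.tmul x y + NCTensor.tmul x y' :=
  congrArg (QuotientAddGroup.mk' (balancedRelations Γ X Y)) (TensorProduct.tmul_add x y y')

theorem NCTensor.add_tmul (x x' : X) (y : Y) :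
    (NCTensor.tmul (x + x') y : NCTensor Γ X Y) = NCTensor.tmul x y + NCTensor.tmul x' y :=
  congrArg (QuotientAddGroup.mk' (balancedRelations Γ X Y)) (TensorProduct.add_tmul x x' y)

/-- The balancing relation `xγ ⊗ y = x ⊗ γy`. -/
theorem NCTensor.smul_tmul (γ : Γ) (x : X) (y : Y) :
    (NCTensor.tmul (MulOpposite.op γ • x) y : NCTensor Γ X Y) = NCTensor.tmul x (γ • y) := by
  refine (QuotientAddGroup.eq_iff_sub_mem).2 ?_
  exact AddSubgroup.subset_closure ⟨x, γ, y, rfl⟩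

/-- Two additive maps out of `X ⊗_Γ Y` agree if they agree on all `x ⊗ y`. -/
theorem NCTensor.hom_ext {A : Type*} [AddCommGroup A] {f g : NCTensor Γ X Y →+ A}
    (h : ∀ x y, f (NCTensor.tmul x y) = g (NCTensor.tmul x y)) : f = g := by
  ext z
  obtain ⟨z, rfl⟩ := QuotientAddGroup.mk'_surjective (balancedRelations Γ X Y) z
  induction z using TensorProduct.induction_on with
  | zero => exact (map_zero f).trans (map_zero g).symm
  | tmul x y => exact h x y
  | add a b ha hb =>
    exact (map_add f _ _).trans ((congrArg₂ _ ha hb).trans (map_add g _ _).symm)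

/-- Left multiplication by `γ` on a bimodule, as a map of right modules. -/
def leftMul [Module Γ X] [SMulCommClass Γ Γᵐᵒᵖ X] (γ : Γ) : X →ₗ[Γᵐᵒᵖ] X where
  toFun x := γ • x
  map_add' := smul_add γ
  map_smul' δ x := smul_comm γ δ x

/-- Right multiplication by `γ` on a bimodule, as a map of left modules. -/
def rightMul [Module Γᵐᵒᵖ Y] [SMulCommClass Γ Γᵐᵒᵖ Y] (γ : Γᵐᵒᵖ) : Y →ₗ[Γ] Y where
  toFun y := γ • y
  map_add' := smul_add γ
  map_smul' δ y := (smul_comm δ γ y).symm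

/-- The left action `γ(x ⊗ y) = (γx) ⊗ y` when `X` is a bimodule, as a ring homomorphism to the
additive endomorphisms. -/
noncomputable def leftAction [Module Γ X] [SMulCommClass Γ Γᵐᵒᵖ X] :
    Γ →+* AddMonoid.End (NCTensor Γ X Y) where
  toFun γ := NCTensor.map (leftMul γ) LinearMap.id
  map_one' := NCTensor.hom_ext fun x y => congrArg (NCTensor.tmul · y) (one_smul Γ x)
  map_mul' a b := NCTensor.hom_ext fun x y => congrArg (NCTensor.tmul · y) (mul_smul a b x)
  map_zero' := NCTensor.hom_ext fun x y => by
    have h := NCTensor.add_tmul (Γ := Γ) (0 : X) 0 y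
    rw [add_zero, left_eq_add] at h
    exact (congrArg (NCTensor.tmul · y) (zero_smul Γ x)).trans h
  map_add' a b := NCTensor.hom_ext fun x y =>
    (congrArg (NCTensor.tmul · y) (add_smul a b x)).trans (NCTensor.add_tmul _ _ _)

/-- The right action `(x ⊗ y)γ = x ⊗ (yγ)` when `Y` is a bimodule, as a ring homomorphism to the
additive endomorphisms. -/
noncomputable def rightAction [Module Γᵐᵒᵖ Y] [SMulCommClass Γ Γᵐᵒᵖ Y] :
    Γᵐᵒᵖ →+* AddMonoid.End (NCTensor Γ X Y) where
  toFun γ := NCTensor.map LinearMap.id (rightMul γ)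
  map_one' := NCTensor.hom_ext fun x y => congrArg (NCTensor.tmul x) (one_smul Γᵐᵒᵖ y)
  map_mul' a b := NCTensor.hom_ext fun x y => congrArg (NCTensor.tmul x) (mul_smul a b y)
  map_zero' := NCTensor.hom_ext fun x y => by
    have h := NCTensor.tmul_add (Γ := Γ) x (0 : Y) 0
    rw [add_zero, left_eq_add] at h
    exact (congrArg (NCTensor.tmul x) (zero_smul Γᵐᵒᵖ y)).trans h
  map_add' a b := NCTensor.hom_ext fun x y =>
    (congrArg (NCTensor.tmul x) (add_smul a b y)).trans (NCTensor.tmul_add _ _ _)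

/-- The left `Γ`-module structure on `X ⊗_Γ Y` for a bimodule `X`. -/
noncomputable abbrev NCTensor.leftModule [Module Γ X] [SMulCommClass Γ Γᵐᵒᵖ X] :
    Module Γ (NCTensor Γ X Y) where
  smul γ z := leftAction γ z
  one_smul z := DFunLike.congr_fun (map_one leftAction) z
  mul_smul a b z := DFunLike.congr_fun (map_mul leftAction a b) z
  smul_zero a := map_zero (leftAction a)
  smul_add a := map_add (leftAction a)
  add_smul a b z := DFunLike.congr_fun (map_add leftAction a b) z
  zero_smul z := DFunLike.congr_fun (map_zero leftAction) z

/-- The right `Γ`-module structure on `X ⊗_Γ Y` for a bimodule `Y`. -/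
noncomputable abbrev NCTensor.rightModule [Module Γᵐᵒᵖ Y] [SMulCommClass Γ Γᵐᵒᵖ Y] :
    Module Γᵐᵒᵖ (NCTensor Γ X Y) where
  smul γ z := rightAction γ z
  one_smul z := DFunLike.congr_fun (map_one rightAction) z
  mul_smul a b z := DFunLike.congr_fun (map_mul rightAction a b) z
  smul_zero a := map_zero (rightAction a)
  smul_add a := map_add (rightAction a)
  add_smul a b z := DFunLike.congr_fun (map_add rightAction a b) z
  zero_smul z := DFunLike.congr_fun (map_zero rightAction) z

variable (Γ) in
/-- A bundled `Γ`-bimodule. -/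
structure BimoduleObj where
  carrier : Type u
  [addCommGroup : AddCommGroup carrier]
  [leftModule : Module Γ carrier]
  [rightModule : Module Γᵐᵒᵖ carrier]
  [smulComm : SMulCommClass Γ Γᵐᵒᵖ carrier]

attribute [instance] BimoduleObj.addCommGroup BimoduleObj.leftModule BimoduleObj.rightModule
  BimoduleObj.smulComm

/-- The tensor product of bimodules over `Γ`, with its outer bimodule structure. -/
noncomputable def BimoduleObj.tensor (X Y : BimoduleObj Γ) : BimoduleObj Γ :=
  { carrier := NCTensor Γ X.carrier Y.carrier
    addCommGroup := inferInstance
    leftModule := NCTensor.leftModule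
    rightModule := NCTensor.rightModule
    smulComm :=
      letI := NCTensor.leftModule (Γ := Γ) (X := X.carrier) (Y := Y.carrier)
      letI := NCTensor.rightModule (Γ := Γ) (X := X.carrier) (Y := Y.carrier)
      ⟨fun a b z => by
        have h : (leftAction a * rightAction b : AddMonoid.End (NCTensor Γ X.carrier Y.carrier)) =
            rightAction b * leftAction a := NCTensor.hom_ext fun x y => rfl
        exact DFunLike.congr_fun h z⟩ }

/-- The tensor powers of a bimodule over `Γ`: the zeroth is `Γ`, the first is `X`, and
`X^{⊗(n+2)} = X^{⊗(n+1)} ⊗_Γ X`. -/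
noncomputable def BimoduleObj.pow (X : BimoduleObj Γ) : ℕ → BimoduleObj Γ
  | 0 => ⟨Γ⟩
  | 1 => X
  | n + 2 => (BimoduleObj.pow X (n + 1)).tensor X

variable (Γ) in
/-- The `n`-th tensor power `M^{⊗n}` over `Γ` of a `Γ`-bimodule `M`. -/
noncomputable abbrev tensorPower (M : Type u) [AddCommGroup M] [Module Γ M] [Module Γᵐᵒᵖ M]
    [SMulCommClass Γ Γᵐᵒᵖ M] (n : ℕ) : BimoduleObj Γ :=
  (BimoduleObj.mk M).pow n

variable (Γ) in
/-- The functor `- ⊗_Γ Y` from right `Γ`-modules to abelian groups. -/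
noncomputable def tensorFunctor (Y : Type u) [AddCommGroup Y] [Module Γ Y] :
    ModuleCat.{u} Γᵐᵒᵖ ⥤ AddCommGrpCat.{u} where
  obj X := AddCommGrpCat.of (NCTensor Γ X Y)
  map f := AddCommGrpCat.ofHom (NCTensor.map f.hom LinearMap.id)
  map_id _ := AddCommGrpCat.hom_ext (NCTensor.hom_ext fun _ _ => rfl)
  map_comp _ _ := AddCommGrpCat.hom_ext (NCTensor.hom_ext fun _ _ => rfl)

instance (Y : Type u) [AddCommGroup Y] [Module Γ Y] : (tensorFunctor Γ Y).Additive where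
  map_add {_ _ f g} := AddCommGrpCat.hom_ext (NCTensor.hom_ext fun x y =>
    NCTensor.add_tmul (f.hom x) (g.hom x) y)

variable (Γ) in
/-- `Tor_i^Γ(X, Y)` for a right `Γ`-module `X` and a left `Γ`-module `Y`: the `i`-th left derived
functor of `- ⊗_Γ Y`, evaluated at `X`. -/
noncomputable def ncTor (i : ℕ) (X Y : Type u) [AddCommGroup X] [Module Γᵐᵒᵖ X]
    [AddCommGroup Y] [Module Γ Y] : AddCommGrpCat.{u} :=
  ((tensorFunctor Γ Y).leftDerived i).obj (ModuleCat.of Γᵐᵒᵖ X)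

variable (Γ) in
/-- A `Γ`-bimodule `M` is left perfect if it has finite projective dimension as a left module and
`Tor_i^Γ(M, M^{⊗j}) = 0` for all `i, j ≥ 1`. -/
structure IsLeftPerfect (M : Type u) [AddCommGroup M] [Module Γ M] [Module Γᵐᵒᵖ M]
    [SMulCommClass Γ Γᵐᵒᵖ M] : Prop where
  projectiveDimension_lt_top : projectiveDimension (ModuleCat.of Γ M) < ⊤
  isZero_tor : ∀ i j : ℕ, 1 ≤ i → 1 ≤ j → IsZero (ncTor Γ i M (tensorPower Γ M j).carrier)

end Tensor

/-! ### Igusa-Todorov distance and extension dimension of an abelian category -/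

section Abelian

variable {C : Type u} [Category.{v} C] [Abelian C]

attribute [local instance] Abelian.hasFiniteBiproducts

/-- `add 𝒰`: the direct summands of finite direct sums of objects of `𝒰`. -/
def addClosure (𝒰 : ObjectProperty C) : ObjectProperty C := fun X =>
  ∃ (n : ℕ) (f : Fin n → C), (∀ i, 𝒰 (f i)) ∧ Nonempty (Retract X (⨁ f))

/-- `add U` for a single object `U`. -/
abbrev addObj (U : C) : ObjectProperty C := addClosure (ObjectProperty.singleton U)

/-- `K` is an `n`-th syzygy of `X`. (Syzygies depend on the choice of the projective covering
objects, only up to projective summands.) -/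
def IsSyzygy : ℕ → C → C → Prop
  | 0, X, K => Nonempty (K ≅ X)
  | n + 1, X, K => ∃ S : ShortComplex C, S.ShortExact ∧ Projective S.X₂ ∧
      Nonempty (S.X₃ ≅ X) ∧ IsSyzygy n S.X₁ K

/-- There is an exact sequence `0 → U_m → ⋯ → U_1 → U_0 → K → 0` with all `U_i` in `add U`.
It is built by splicing short exact sequences. -/
def HasAddResolution (U : C) : ℕ → C → Prop
  | 0, K => addObj U K
  | m + 1, K => ∃ S : ShortComplex C, S.ShortExact ∧ addObj U S.X₂ ∧
      Nonempty (S.X₃ ≅ K) ∧ HasAddResolution U m S.X₁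

variable (C) in
/-- `C` is an `(m, n)`-Igusa-Todorov category. -/
def IsIgusaTodorovCategory (m n : ℕ) : Prop :=
  ∃ U : C, ∀ A : C, ∃ K : C, IsSyzygy n A K ∧ HasAddResolution U m K

variable (C) in
/-- The Igusa-Todorov distance of `C`. It is `⊤` if `C` is `(m, n)`-Igusa-Todorov for no `m, n`. -/
noncomputable def igusaTodorovDistance : ℕ∞ :=
  ⨅ (m : ℕ) (_ : ∃ n, IsIgusaTodorovCategory C m n), (m : ℕ∞)

/-- `𝒰 • 𝒱`: the direct summands of finite direct sums of objects `A` that sit in a short exact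
sequence `0 → U → A → V → 0` with `U` in `𝒰` and `V` in `𝒱`. -/
def extProduct (𝒰 𝒱 : ObjectProperty C) : ObjectProperty C :=
  addClosure fun A => ∃ S : ShortComplex C, S.ShortExact ∧ 𝒰 S.X₁ ∧ 𝒱 S.X₃ ∧ Nonempty (S.X₂ ≅ A)

/-- `[T]_n`: `[T]_0 = 0`, `[T]_1 = add T` and `[T]_n = [T]_1 • [T]_{n-1}` for `n ≥ 2`. -/
def extPower (T : C) : ℕ → ObjectProperty C
  | 0 => fun X => IsZero X
  | 1 => addObj T
  | n + 2 => extProduct (addObj T) (extPower T (n + 1))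

variable (C) in
/-- The extension dimension of `C`. -/
noncomputable def extensionDimension : ℕ∞ :=
  ⨅ (n : ℕ) (_ : ∃ T : C, ∀ X : C, extPower T (n + 1) X), (n : ℕ∞)

end Abelian

/-! ### Rouquier dimension -/

/-- The Rouquier dimension of a triangulated category. For the property of being equal to `T`,
`triangEnvelopeIter n` is `⟨T⟩_{n+1}`: the objects reached from `T` by shifts, finite direct sums,
direct summands and at most `n` extensions. -/
noncomputable def rouquierDimension (𝒯 : Type u) [Category.{v} 𝒯] [HasZeroObject 𝒯]
    [HasShift 𝒯 ℤ] [Preadditive 𝒯] [∀ n : ℤ, (shiftFunctor 𝒯 n).Additive]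
    [Pretriangulated 𝒯] : ℕ∞ :=
  ⨅ (n : ℕ) (_ : ∃ T : 𝒯, (ObjectProperty.singleton T).triangEnvelopeIter n = ⊤), (n : ℕ∞)

/-- The Rouquier dimension of the bounded derived category of an abelian category. -/
noncomputable def derivedDimension (C : Type u) [Category.{v} C] [Abelian C] : ℕ∞ :=
  letI := HasDerivedCategory.standard C
  rouquierDimension (DerivedCategory.Bounded C)

/-! ### Finitely generated right modules over a ring -/

/-- An algebra that is module-finite over a commutative Noetherian ring is right Noetherian, so
its finitely generated right modules form an abelian category. -/
theorem isNoetherianRing_op (R : Type w) (Λ : Type u) [CommRing R] [IsNoetherianRing R] [Ring Λ]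
    [Algebra R Λ] [Module.Finite R Λ] : IsNoetherianRing Λᵐᵒᵖ :=
  haveI : Module.Finite R Λᵐᵒᵖ := Module.Finite.equiv (MulOpposite.opLinearEquiv R (M := Λ))
  haveI : IsNoetherian R Λᵐᵒᵖ := isNoetherian_of_isNoetherianRing_of_finite R Λᵐᵒᵖ
  isNoetherian_of_tower R inferInstance

/-- The trivial extension of a module-finite algebra by a finitely generated module is
module-finite. -/
theorem finite_trivSqZeroExt (R : Type w) (Γ M : Type u) [CommRing R] [Ring Γ] [Algebra R Γ]
    [Module.Finite R Γ] [AddCommGroup M] [Module R M] [Module.Finite R M] :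
    Module.Finite R (TrivSqZeroExt Γ M) :=
  inferInstanceAs (Module.Finite R (Γ × M))

section Ring

variable (Λ : Type u) [Ring Λ] [IsNoetherianRing Λᵐᵒᵖ]

/-- The category `mod-Λ` of finitely generated right `Λ`-modules. -/
abbrev ModCat : Type (u + 1) := FGModuleCat.{u} Λᵐᵒᵖ

/-- `IT(Λ)`, the Igusa-Todorov distance of `mod-Λ`. -/
noncomputable abbrev IT : ℕ∞ := igusaTodorovDistance (ModCat Λ)

/-- `dim Λ`, the extension dimension of `mod-Λ`. -/
noncomputable abbrev extDim : ℕ∞ := extensionDimension (ModCat Λ)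

/-- The Rouquier dimension of `D^b(mod-Λ)`. -/
noncomputable abbrev derDim : ℕ∞ := derivedDimension (ModCat Λ)

end Ring

end CleftDim

/- Write `Λ = Γ ⋉ M`. Restriction along `Γ → Λ` is a retraction of restriction along `Λ → Γ`, and
exact functors transport resolutions, extensions and triangles; this gives the lower bounds.

For the upper bounds in (2) and (3), let `X₀` be the submodule of a `Λ`-module `X` annihilated by
`M`. As `M` has square zero in `Λ`, both `X₀` and `X / X₀` are `Γ`-modules restricted along
`Λ → Γ`, functorially in `X`. Hence two steps over `Γ` suffice to build one step over `Λ`, and one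
step suffices when `M = 0`.

For the upper bound in (1), let `GX` be the kernel of the multiplication `X ⊗_Γ Λ → X`. As a right
`Γ`-module it is isomorphic to `X ⊗_Γ M`, so `G^n X` is generated by homomorphic images of
`M^{⊗n} = 0`. The Igusa-Todorov distance plus one is the least number of layers from `add V`, for a
single object `V`, of which suitable high syzygies of all objects are iterated extensions. When
`M` is projective on the left, `- ⊗_Γ Λ` is exact and preserves projectives, and each of the `n`
exact sequences `0 → G^{i+1} X → G^i X ⊗_Γ Λ → G^i X → 0` contributes the layers of one
`Γ`-module. -/

namespace CleftDim

theorem iInf_add_one_le_mul_iInf_add_one {P Q : ℕ → Prop} {k : ℕ} (hk : k ≠ 0)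
    (h : ∀ m l, l + 1 = k * (m + 1) → P m → Q l) :
    (⨅ (l : ℕ) (_ : Q l), (l : ℕ∞)) + 1 ≤ k * ((⨅ (m : ℕ) (_ : P m), (m : ℕ∞)) + 1) := by
  simp only [ENat.iInf₂_add, ENat.mul_iInf_of_ne (Nat.cast_ne_zero.2 hk)]
  refine le_iInf₂ fun m hm => ?_
  obtain ⟨l, hl⟩ : ∃ l, l + 1 = k * (m + 1) :=
    ⟨_, Nat.sub_add_cancel (Nat.one_le_iff_ne_zero.2 (Nat.mul_ne_zero hk m.succ_ne_zero))⟩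
  exact (iInf₂_le l (h m l hl hm)).trans (by exact_mod_cast hl.le)

/-! ### Rouquier dimension and exact functors -/

section DerivedDimension

open ObjectProperty Pretriangulated DerivedCategory.TStructure

theorem triangEnvelopeIter_le_inverseImage {𝒯 𝒯' : Type*} [Category* 𝒯] [Category* 𝒯']
    [HasZeroObject 𝒯] [HasShift 𝒯 ℤ] [Preadditive 𝒯] [∀ n : ℤ, (shiftFunctor 𝒯 n).Additive]
    [Pretriangulated 𝒯] [HasZeroObject 𝒯'] [HasShift 𝒯' ℤ] [Preadditive 𝒯']
    [∀ n : ℤ, (shiftFunctor 𝒯' n).Additive] [Pretriangulated 𝒯']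
    (G : 𝒯 ⥤ 𝒯') [G.CommShift ℤ] [G.IsTriangulated] {P : ObjectProperty 𝒯}
    {Q : ObjectProperty 𝒯'} (h : P ≤ Q.inverseImage G) (n : ℕ) :
    P.triangEnvelopeIter n ≤ (Q.triangEnvelopeIter n).inverseImage G := by
  have base : (P.shiftClosure ℤ).binaryProductsClosure.retractClosure ≤
      ((Q.shiftClosure ℤ).binaryProductsClosure.retractClosure).inverseImage G := by
    rintro X ⟨Y, hY, ⟨r⟩⟩
    refine ⟨G.obj Y, ?_, ⟨r.map G⟩⟩
    clear r
    induction hY with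
    | of_mem X hX =>
      obtain ⟨Z, a, e, hZ⟩ := hX
      exact .of_mem _ ⟨G.obj Z, a, G.mapIso e ≪≫ (G.commShiftIso a).app Z, h _ hZ⟩
    | of_isoClosure e _ ih => exact .of_isoClosure (G.mapIso e) ih
    | of_limitPresentation pres _ ih =>
      exact .of_limitPresentation (a := ()) (pres.map G) ih
  induction n with
  | zero => simpa only [triangEnvelopeIter_zero] using base
  | succ n ih =>
    simp only [triangEnvelopeIter_succ]
    rintro X ⟨Y, ⟨A, B, f, g, k, hT, hA, hB⟩, ⟨r⟩⟩
    exact ⟨G.obj Y, ⟨_, _, _, _, _, G.map_distinguished _ hT, base _ hA, ih _ hB⟩, ⟨r.map G⟩⟩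

theorem extensionProduct_of_map_distinguished {𝒯 𝒯' : Type*} [Category* 𝒯] [Category* 𝒯']
    [HasZeroObject 𝒯] [HasShift 𝒯 ℤ] [Preadditive 𝒯] [∀ n : ℤ, (shiftFunctor 𝒯 n).Additive]
    [Pretriangulated 𝒯] [HasZeroObject 𝒯'] [HasShift 𝒯' ℤ] [Preadditive 𝒯']
    [∀ n : ℤ, (shiftFunctor 𝒯' n).Additive] [Pretriangulated 𝒯']
    (G : 𝒯 ⥤ 𝒯') [G.CommShift ℤ] [G.IsTriangulated] [G.Full] [G.Faithful]
    {U V : ObjectProperty 𝒯} {A X B : 𝒯} (f : G.obj A ⟶ G.obj X) (g : G.obj X ⟶ G.obj B)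
    (k : G.obj B ⟶ (G.obj A)⟦(1 : ℤ)⟧) (hT : Triangle.mk f g k ∈ distTriang 𝒯')
    (hA : U A) (hB : V B) : extensionProduct U V X := by
  obtain ⟨f, rfl⟩ := G.map_surjective f
  obtain ⟨g, rfl⟩ := G.map_surjective g
  obtain ⟨k, rfl⟩ : ∃ k' : B ⟶ A⟦(1 : ℤ)⟧, G.map k' ≫ (G.commShiftIso (1 : ℤ)).hom.app A = k := by
    refine ⟨G.preimage (k ≫ (G.commShiftIso (1 : ℤ)).inv.app A), ?_⟩
    rw [G.map_preimage, Category.assoc, Iso.inv_hom_id_app]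
    exact Category.comp_id k
  exact ⟨A, B, f, g, k, (G.map_distinguished_iff _).1 hT, hA, hB⟩

variable {C D : Type u} [Category.{v} C] [Category.{v} D] [Abelian C] [Abelian D]

section Bounded

variable [HasDerivedCategory.{w} C] [HasDerivedCategory.{w} D]

theorem bounded_mapDerivedCategory (F : C ⥤ D) [F.Additive] [PreservesFiniteLimits F]
    [PreservesFiniteColimits F] {X : DerivedCategory C}
    (hX : (t : Triangulated.TStructure (DerivedCategory C)).bounded X) :
    (t : Triangulated.TStructure (DerivedCategory D)).bounded (F.mapDerivedCategory.obj X) := by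
  obtain ⟨⟨a, ⟨K, e, hK⟩⟩, ⟨b, ⟨L, e', hL⟩⟩⟩ := hX
  exact ⟨⟨a, ⟨(F.mapHomologicalComplex _).obj K,
    F.mapDerivedCategory.mapIso e ≪≫ F.mapDerivedCategoryFactors.app K, inferInstance⟩⟩,
    ⟨b, ⟨(F.mapHomologicalComplex _).obj L,
    F.mapDerivedCategory.mapIso e' ≪≫ F.mapDerivedCategoryFactors.app L, inferInstance⟩⟩⟩

/-- The functor induced by an exact functor on bounded derived categories. -/
noncomputable abbrev mapBounded (F : C ⥤ D) [F.Additive] [PreservesFiniteLimits F]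
    [PreservesFiniteColimits F] : DerivedCategory.Bounded C ⥤ DerivedCategory.Bounded D :=
  ObjectProperty.lift _ (DerivedCategory.Bounded.ι ⋙ F.mapDerivedCategory)
    fun X => bounded_mapDerivedCategory F X.2

/-- A bounded complex, as an object of the bounded derived category. -/
noncomputable def boundedQ (K : CochainComplex C ℤ) (a b : ℤ) [K.IsStrictlyGE a]
    [K.IsStrictlyLE b] : DerivedCategory.Bounded C :=
  ⟨DerivedCategory.Q.obj K, ⟨a, ⟨K, Iso.refl _, inferInstance⟩⟩,
    ⟨b, ⟨K, Iso.refl _, inferInstance⟩⟩⟩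

theorem exists_iso_boundedQ (X : DerivedCategory.Bounded C) :
    ∃ (K : CochainComplex C ℤ) (a b : ℤ) (_ : K.IsStrictlyGE a) (_ : K.IsStrictlyLE b),
      Nonempty (X ≅ boundedQ K a b) := by
  obtain ⟨X, ⟨a, ha⟩, ⟨b, hb⟩⟩ := X
  have : X.IsGE a := ⟨ha.ge⟩
  have : X.IsLE b := ⟨hb.le⟩
  obtain ⟨K, h₁, h₂, ⟨e⟩⟩ := X.exists_iso_Q_obj_of_isGE_of_isLE a b
  exact ⟨K, a, b, h₁, h₂, ⟨(ObjectProperty.fullyFaithfulι _).preimageIso e⟩⟩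

/-- Isomorphic bounded complexes are isomorphic in the bounded derived category. -/
noncomputable def boundedQIso {K L : CochainComplex C ℤ} (e : K ≅ L) (a b : ℤ)
    [K.IsStrictlyGE a] [K.IsStrictlyLE b] [L.IsStrictlyGE a] [L.IsStrictlyLE b] :
    boundedQ K a b ≅ boundedQ L a b :=
  (ObjectProperty.fullyFaithfulι _).preimageIso (DerivedCategory.Q.mapIso e)

/-- The derived functor of an exact functor is computed termwise on bounded complexes. -/
noncomputable def mapBoundedObjIso (F : C ⥤ D) [F.Additive] [PreservesFiniteLimits F]
    [PreservesFiniteColimits F] (K : CochainComplex C ℤ) (a b : ℤ) [K.IsStrictlyGE a]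
    [K.IsStrictlyLE b] :
    (mapBounded F).obj (boundedQ K a b) ≅ boundedQ ((F.mapHomologicalComplex _).obj K) a b :=
  (ObjectProperty.fullyFaithfulι _).preimageIso (F.mapDerivedCategoryFactors.app K)

theorem triangEnvelopeIter_boundedQ_mapHomologicalComplex (F : C ⥤ D) [F.Additive]
    [PreservesFiniteLimits F] [PreservesFiniteColimits F] {T : DerivedCategory.Bounded C} {m : ℕ}
    (hT : (ObjectProperty.singleton T).triangEnvelopeIter m = ⊤) (K : CochainComplex C ℤ)
    (a b : ℤ) [K.IsStrictlyGE a] [K.IsStrictlyLE b] :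
    (ObjectProperty.singleton ((mapBounded F).obj T)).triangEnvelopeIter m
      (boundedQ ((F.mapHomologicalComplex _).obj K) a b) := by
  refine ObjectProperty.prop_of_iso _ (mapBoundedObjIso F K a b)
    (triangEnvelopeIter_le_inverseImage (mapBounded F) (P := ObjectProperty.singleton T) ?_ m _ ?_)
  · exact singleton_le_iff.2 ((singleton_iff _ _).2 rfl)
  · rw [hT]; trivial

theorem extensionProduct_boundedQ {U V : ObjectProperty (DerivedCategory.Bounded C)}
    {S : ShortComplex (CochainComplex C ℤ)}
    (hS : ∀ i, (S.map (HomologicalComplex.eval C _ i)).ShortExact) (a b : ℤ)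
    [S.X₁.IsStrictlyGE a] [S.X₁.IsStrictlyLE b] [S.X₂.IsStrictlyGE a] [S.X₂.IsStrictlyLE b]
    [S.X₃.IsStrictlyGE a] [S.X₃.IsStrictlyLE b]
    (h₁ : U (boundedQ S.X₁ a b)) (h₃ : V (boundedQ S.X₃ a b)) :
    extensionProduct U V (boundedQ S.X₂ a b) := by
  have hS' : S.ShortExact := HomologicalComplex.shortExact_of_degreewise_shortExact S hS
  exact extensionProduct_of_map_distinguished DerivedCategory.Bounded.ι
    (A := boundedQ S.X₁ a b) (X := boundedQ S.X₂ a b) (B := boundedQ S.X₃ a b)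
    (DerivedCategory.Q.map S.f) (DerivedCategory.Q.map S.g) (DerivedCategory.triangleOfSESδ hS')
    (DerivedCategory.triangleOfSES_distinguished hS') h₁ h₃

end Bounded

theorem derivedDimension_le_of_section (F : C ⥤ D) [F.Additive] [PreservesFiniteLimits F]
    [PreservesFiniteColimits F] (G : D ⥤ C) [G.Additive] (e : G ⋙ F ≅ 𝟭 D) :
    derivedDimension D ≤ derivedDimension C := by
  let _ := HasDerivedCategory.standard C
  let _ := HasDerivedCategory.standard D
  refine le_iInf₂ fun n ⟨T, hT⟩ => iInf₂_le n ⟨(mapBounded F).obj T, top_unique fun X _ => ?_⟩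
  obtain ⟨K, a, b, _, _, ⟨i⟩⟩ := exists_iso_boundedQ X
  let eK : (F.mapHomologicalComplex _).obj ((G.mapHomologicalComplex _).obj K) ≅ K :=
    HomologicalComplex.Hom.isoOfComponents (fun j => e.app (K.X j))
      (fun j l _ => (e.hom.naturality (K.d j l)).symm)
  exact ObjectProperty.prop_of_iso _ (boundedQIso eK a b ≪≫ i.symm)
    (triangEnvelopeIter_boundedQ_mapHomologicalComplex F hT _ a b)

/-- The functors `A` and `B` need not be exact: applied degreewise to a bounded complex, the
natural extension still gives a short exact sequence of complexes, hence a triangle. -/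
theorem derivedDimension_add_one_le_of_extension (I : D ⥤ C) [I.Additive]
    [PreservesFiniteLimits I] [PreservesFiniteColimits I] (A B : C ⥤ D) [A.Additive] [B.Additive]
    (f : A ⋙ I ⟶ 𝟭 C) (g : 𝟭 C ⟶ B ⋙ I) (w : ∀ X, f.app X ≫ g.app X = 0)
    (h : ∀ X, (ShortComplex.mk (f.app X) (g.app X) (w X)).ShortExact) :
    derivedDimension C + 1 ≤ (2 : ℕ) * (derivedDimension D + 1) := by
  let _ := HasDerivedCategory.standard C
  let _ := HasDerivedCategory.standard D
  refine iInf_add_one_le_mul_iInf_add_one two_ne_zero ?_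
  rintro m l hl ⟨T, hT⟩
  refine ⟨(mapBounded I).obj T, top_unique fun X _ => ?_⟩
  obtain ⟨K, a, b, _, _, ⟨i⟩⟩ := exists_iso_boundedQ X
  let S : ShortComplex (CochainComplex C ℤ) := ShortComplex.mk
    (X₁ := (I.mapHomologicalComplex _).obj ((A.mapHomologicalComplex _).obj K)) (X₂ := K)
    (X₃ := (I.mapHomologicalComplex _).obj ((B.mapHomologicalComplex _).obj K))
    { f := fun j => f.app (K.X j), comm' := fun j l _ => (f.naturality (K.d j l)).symm }
    { f := fun j => g.app (K.X j), comm' := fun j l _ => (g.naturality (K.d j l)).symm }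
    (by ext j; exact w (K.X j))
  have hX : extensionProduct _ _ (boundedQ K a b) :=
    extensionProduct_boundedQ (S := S) (fun j => h (K.X j)) a b
      (triangEnvelopeIter_boundedQ_mapHomologicalComplex I hT _ a b)
      (triangEnvelopeIter_boundedQ_mapHomologicalComplex I hT _ a b)
  rw [show l = (m + 1) + m by lia, triangEnvelopeIter_add _ rfl]
  exact ObjectProperty.prop_of_iso _ i.symm (le_retractClosure _ _ hX)

end DerivedDimension

/-! ### Additive closures -/

section Abelian

variable {C : Type u} [Category.{v} C] [Abelian C]

attribute [local instance] Abelian.hasFiniteBiproducts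

open scoped ZeroObject

theorem addClosure_iff {𝒰 : ObjectProperty C} {X : C} : addClosure 𝒰 X ↔
    ∃ (ι : Type) (_ : Fintype ι) (f : ι → C) (a : ∀ i, X ⟶ f i) (b : ∀ i, f i ⟶ X),
      (∀ i, 𝒰 (f i)) ∧ ∑ i, a i ≫ b i = 𝟙 X := by
  constructor
  · rintro ⟨n, f, hf, ⟨r⟩⟩
    refine ⟨Fin n, inferInstance, f, fun i => r.i ≫ biproduct.π f i,
      fun i => biproduct.ι f i ≫ r.r, hf, ?_⟩
    have := congrArg (fun k => r.i ≫ k ≫ r.r) (biproduct.total (f := f))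
    simpa only [Preadditive.comp_sum, Preadditive.sum_comp, Category.assoc, Category.id_comp,
      r.retract] using this
  · rintro ⟨ι, _, f, a, b, hf, h⟩
    let e := (Fintype.equivFin ι).symm
    refine ⟨_, f ∘ e, fun i => hf _, ⟨⟨biproduct.lift fun i => a (e i),
      biproduct.desc fun i => b (e i), ?_⟩⟩⟩
    rw [biproduct.lift_desc, ← h]
    exact e.sum_comp fun i => a i ≫ b i

instance (𝒰 : ObjectProperty C) : (addClosure 𝒰).IsStableUnderRetracts where
  of_retract := by
    rintro X Y r ⟨n, f, hf, ⟨s⟩⟩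
    exact ⟨n, f, hf, ⟨r.trans s⟩⟩

theorem addClosure_of_isZero {𝒰 : ObjectProperty C} {X : C} (h : IsZero X) : addClosure 𝒰 X :=
  ⟨0, fun i => i.elim0, fun i => i.elim0, ⟨h.retract _⟩⟩

theorem le_addClosure (𝒰 : ObjectProperty C) : 𝒰 ≤ addClosure 𝒰 := fun X hX =>
  addClosure_iff.2 ⟨Unit, inferInstance, fun _ => X, fun _ => 𝟙 X, fun _ => 𝟙 X,
    fun _ => hX, by simp⟩

theorem addClosure_biprod {𝒰 : ObjectProperty C} {X Y : C} (hX : addClosure 𝒰 X)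
    (hY : addClosure 𝒰 Y) : addClosure 𝒰 (X ⊞ Y) := by
  obtain ⟨ι, _, f, a, b, hf, h⟩ := addClosure_iff.1 hX
  obtain ⟨κ, _, g, c, d, hg, k⟩ := addClosure_iff.1 hY
  refine addClosure_iff.2 ⟨ι ⊕ κ, inferInstance, Sum.elim f g,
    Sum.rec (fun i => biprod.fst ≫ a i) (fun i => biprod.snd ≫ c i),
    Sum.rec (fun i => b i ≫ biprod.inl) (fun i => d i ≫ biprod.inr),
    Sum.rec hf hg, ?_⟩
  have h₁ : ∑ i, (biprod.fst ≫ a i) ≫ b i ≫ biprod.inl =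
      (biprod.fst ≫ biprod.inl : X ⊞ Y ⟶ X ⊞ Y) := by
    simpa [Preadditive.comp_sum, Preadditive.sum_comp] using
      congrArg (fun k => (biprod.fst : X ⊞ Y ⟶ X) ≫ k ≫ (biprod.inl : X ⟶ X ⊞ Y)) h
  have h₂ : ∑ i, (biprod.snd ≫ c i) ≫ d i ≫ biprod.inr =
      (biprod.snd ≫ biprod.inr : X ⊞ Y ⟶ X ⊞ Y) := by
    simpa [Preadditive.comp_sum, Preadditive.sum_comp] using
      congrArg (fun k => (biprod.snd : X ⊞ Y ⟶ Y) ≫ k ≫ (biprod.inr : Y ⟶ X ⊞ Y)) k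
  rw [Fintype.sum_sum_type]
  exact (congrArg₂ (· + ·) h₁ h₂).trans biprod.total

theorem addClosure_le {𝒰 𝒬 : ObjectProperty C} [𝒬.IsStableUnderRetracts] (h : 𝒰 ≤ 𝒬)
    (hzero : ∀ {X : C}, IsZero X → 𝒬 X) (hbiprod : ∀ {X Y : C}, 𝒬 X → 𝒬 Y → 𝒬 (X ⊞ Y)) :
    addClosure 𝒰 ≤ 𝒬 := by
  rintro X ⟨n, f, hf, ⟨r⟩⟩
  refine 𝒬.prop_of_retract r ?_
  clear r
  induction n with
  | zero =>
    refine hzero ((IsZero.iff_id_eq_zero _).2 ?_)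
    ext i
    exact i.elim0
  | succ n ih =>
    refine 𝒬.prop_of_retract ⟨biprod.lift (biproduct.π f 0) (biproduct.lift fun i : Fin n =>
      biproduct.π f i.succ),
      biprod.desc (biproduct.ι f 0) (biproduct.desc fun i : Fin n => biproduct.ι f i.succ), ?_⟩
      (hbiprod (h _ (hf 0)) (ih (fun i => f i.succ) fun i => hf _))
    rw [biprod.lift_desc, biproduct.lift_desc, ← Fin.sum_univ_succ
      (f := fun i => biproduct.π f i ≫ biproduct.ι f i), biproduct.total]

theorem addObj_self (U : C) : addObj U U :=
  le_addClosure _ _ ((ObjectProperty.singleton_iff _ _).2 rfl)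

theorem addObj_le {U V : C} (h : addObj V U) : addObj U ≤ addObj V :=
  addClosure_le (ObjectProperty.singleton_le_iff.2 h) addClosure_of_isZero addClosure_biprod

theorem addObj_le_biprod_left (U V : C) : addObj U ≤ addObj (U ⊞ V) :=
  addObj_le ((addObj _).prop_of_retract ⟨biprod.inl, biprod.fst, by simp⟩ (addObj_self _))

theorem addObj_le_biprod_right (U V : C) : addObj V ≤ addObj (U ⊞ V) :=
  addObj_le ((addObj _).prop_of_retract ⟨biprod.inr, biprod.snd, by simp⟩ (addObj_self _))

/-! ### Extensions -/

/-- There is a short exact sequence `0 → A → X → B → 0`; the maps are existentially quantified. -/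
def IsExtension (A X B : C) : Prop :=
  ∃ (f : A ⟶ X) (g : X ⟶ B) (w : f ≫ g = 0), (ShortComplex.mk f g w).ShortExact

namespace IsExtension

theorem of_shortExact {S : ShortComplex C} (h : S.ShortExact) : IsExtension S.X₁ S.X₂ S.X₃ :=
  ⟨S.f, S.g, S.zero, h⟩

theorem of_iso {A X B A' X' B' : C} (h : IsExtension A X B) (a : A ≅ A') (x : X ≅ X')
    (b : B ≅ B') : IsExtension A' X' B' := by
  obtain ⟨f, g, w, h⟩ := h
  refine ⟨a.inv ≫ f ≫ x.hom, x.inv ≫ g ≫ b.hom, by simp [reassoc_of% w], ?_⟩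
  exact ShortComplex.shortExact_of_iso (ShortComplex.isoMk a x b (by simp) (by simp)) h

open Opposite in
theorem op {A X B : C} (h : IsExtension A X B) : IsExtension (op B) (op X) (op A) :=
  have ⟨_, _, _, h⟩ := h
  of_shortExact h.op

theorem unop {A X B : Cᵒᵖ} (h : IsExtension A X B) :
    IsExtension B.unop X.unop A.unop :=
  have ⟨_, _, _, h⟩ := h
  of_shortExact h.unop

theorem of_isZero_left {Z : C} (hZ : IsZero Z) (X : C) : IsExtension Z X X :=
  of_shortExact (ShortComplex.Splitting.ofIsZeroOfIsIso
    (ShortComplex.mk (0 : Z ⟶ X) (𝟙 X) zero_comp) hZ inferInstance).shortExact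

theorem of_isZero_right {Z : C} (hZ : IsZero Z) (X : C) : IsExtension X X Z :=
  of_shortExact (ShortComplex.Splitting.ofIsIsoOfIsZero
    (ShortComplex.mk (𝟙 X) (0 : X ⟶ Z) comp_zero) inferInstance hZ).shortExact

theorem nonempty_iso_of_isZero_left {A X B : C} (h : IsExtension A X B)
    (hA : IsZero A) : Nonempty (X ≅ B) := by
  obtain ⟨f, g, w, h⟩ := h
  have := h.isIso_g_iff.2 hA
  exact ⟨asIso g⟩

theorem nonempty_iso_of_isZero_right {A X B : C} (h : IsExtension A X B)
    (hB : IsZero B) : Nonempty (A ≅ X) := by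
  obtain ⟨f, g, w, h⟩ := h
  have := h.isIso_f_iff.2 hB
  exact ⟨asIso f⟩

end IsExtension

theorem shortExact_of_forall_exists_lift {A X B : C} (f : A ⟶ X) (g : X ⟶ B) (w : f ≫ g = 0)
    [Mono f] [Epi g] (h : ∀ {W : C} (k : W ⟶ X), k ≫ g = 0 → ∃ l : W ⟶ A, l ≫ f = k) :
    (ShortComplex.mk f g w).ShortExact := by
  choose l hl using @h
  exact ⟨ShortComplex.exact_of_f_is_kernel _ (KernelFork.IsLimit.ofι' f w fun k hk =>
    ⟨l k hk, hl k hk⟩)⟩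

theorem exists_lift_of_shortExact {S : ShortComplex C} (hS : S.ShortExact) {W : C} (k : W ⟶ S.X₂)
    (hk : k ≫ S.g = 0) : ∃ l : W ⟶ S.X₁, l ≫ S.f = k :=
  have := hS.mono_f
  ⟨hS.exact.lift k hk, hS.exact.lift_f k hk⟩

theorem exists_shortExact_of_isPullback {K X Y Z P : C} {f : K ⟶ X} {g : X ⟶ Y} {w : f ≫ g = 0}
    (hS : (ShortComplex.mk f g w).ShortExact) {h : Z ⟶ Y} {p : P ⟶ X} {q : P ⟶ Z}
    (sq : IsPullback p q g h) :
    ∃ (k : K ⟶ P) (w' : k ≫ q = 0), k ≫ p = f ∧ (ShortComplex.mk k q w').ShortExact := by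
  have : Epi g := hS.epi_g
  have : Mono f := hS.mono_f
  have : Epi q := by
    rw [← sq.isoPullback_hom_snd]
    infer_instance
  obtain ⟨k, hkp, hkq⟩ : ∃ k : K ⟶ P, k ≫ p = f ∧ k ≫ q = 0 :=
    ⟨sq.lift f 0 (by simp [w]), sq.lift_fst _ _ _, sq.lift_snd _ _ _⟩
  have : Mono k := by
    have : Mono (k ≫ p) := by rwa [hkp]
    exact mono_of_mono k p
  refine ⟨k, hkq, hkp, shortExact_of_forall_exists_lift _ _ _ fun j hj => ?_⟩
  obtain ⟨l, hl⟩ := exists_lift_of_shortExact hS (j ≫ p) (by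
    change (j ≫ p) ≫ g = 0
    rw [Category.assoc, sq.w, reassoc_of% hj, zero_comp])
  exact ⟨l, sq.hom_ext (by simpa [hkp] using hl) (by simp [hj, hkq])⟩

namespace IsExtension

theorem biprod {A X B A' X' B' : C} (h : IsExtension A X B)
    (h' : IsExtension A' X' B') : IsExtension (A ⊞ A') (X ⊞ X') (B ⊞ B') := by
  obtain ⟨f, g, w, h⟩ := h
  obtain ⟨f', g', w', h'⟩ := h'
  have : Mono f := h.mono_f
  have : Mono f' := h'.mono_f
  have : Epi g := h.epi_g
  have : Epi g' := h'.epi_g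
  refine ⟨biprod.map f f', biprod.map g g', by ext <;> simp [w, w'],
    shortExact_of_forall_exists_lift _ _ _ fun k hk => ?_⟩
  obtain ⟨l, hl⟩ := exists_lift_of_shortExact h (k ≫ biprod.fst)
    (by simpa using congrArg (· ≫ biprod.fst) hk)
  obtain ⟨l', hl'⟩ := exists_lift_of_shortExact h' (k ≫ biprod.snd)
    (by simpa using congrArg (· ≫ biprod.snd) hk)
  exact ⟨biprod.lift l l', by ext <;> simp_all⟩

theorem exists_kernel_comp {A W Y B X : C} (h : IsExtension A W Y) (h' : IsExtension B Y X) :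
    ∃ Z : C, IsExtension A Z B ∧ IsExtension Z W X := by
  obtain ⟨f, g, w, h⟩ := h
  obtain ⟨i, p, w', h'⟩ := h'
  have : Epi g := h.epi_g
  have : Epi p := h'.epi_g
  have : Mono i := h'.mono_f
  have sq := IsPullback.of_hasPullback g i
  obtain ⟨k, w₁, -, hk⟩ := exists_shortExact_of_isPullback h sq
  refine ⟨_, ⟨_, _, _, hk⟩, ⟨pullback.fst g i, g ≫ p, ?_, ?_⟩⟩
  · rw [sq.w_assoc, w', comp_zero]
  · refine shortExact_of_forall_exists_lift _ _ _ fun {W} k hk => ?_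
    obtain ⟨l, hl⟩ := exists_lift_of_shortExact h' (k ≫ g) (by simpa using hk)
    exact ⟨sq.lift k l hl.symm, sq.lift_fst _ _ _⟩

theorem exists_cokernel_comp {U A V X B : C} (h : IsExtension U A V) (h' : IsExtension A X B) :
    ∃ Y : C, IsExtension U X Y ∧ IsExtension V Y B :=
  have ⟨Y, hY, hY'⟩ := h'.op.exists_kernel_comp h.op
  ⟨Y.unop, hY'.unop, hY.unop⟩

theorem exists_retract_of_right {A X B B' : C} (h : IsExtension A X B) (r : Retract B B') :
    ∃ X' : C, IsExtension A X' B' ∧ Nonempty (Retract X X') := by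
  obtain ⟨f, g, w, h⟩ := h
  have sq := IsPullback.of_hasPullback g r.r
  obtain ⟨k, w₁, -, hk⟩ := exists_shortExact_of_isPullback h sq
  exact ⟨_, ⟨_, _, _, hk⟩, ⟨⟨sq.lift (𝟙 X) (g ≫ r.i) (by simp), pullback.fst g r.r, by simp⟩⟩⟩

theorem exists_retract_of_left {A A' X B : C} (h : IsExtension A X B) (r : Retract A A') :
    ∃ X' : C, IsExtension A' X' B ∧ Nonempty (Retract X X') :=
  have ⟨X', hX', ⟨s⟩⟩ := h.op.exists_retract_of_right r.op
  ⟨X'.unop, hX'.unop, ⟨⟨s.r.unop, s.i.unop, congrArg Quiver.Hom.unop s.retract⟩⟩⟩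

end IsExtension

/-- The class of extensions `X` of an object of `𝒱` by an object of `𝒰`: those in a short exact
sequence `0 → U → X → V → 0`. Unlike in `extProduct`, no additive closure is taken. -/
def extensionsOf (𝒰 𝒱 : ObjectProperty C) : ObjectProperty C := fun X =>
  ∃ A B : C, 𝒰 A ∧ 𝒱 B ∧ IsExtension A X B

instance (𝒰 𝒱 : ObjectProperty C) : (extensionsOf 𝒰 𝒱).IsClosedUnderIsomorphisms where
  of_iso := fun e ⟨A, B, hA, hB, h⟩ => ⟨A, B, hA, hB, h.of_iso (.refl _) e (.refl _)⟩

theorem extensionsOf_mono {𝒰 𝒰' 𝒱 𝒱' : ObjectProperty C} (h : 𝒰 ≤ 𝒰') (h' : 𝒱 ≤ 𝒱') :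
    extensionsOf 𝒰 𝒱 ≤ extensionsOf 𝒰' 𝒱' :=
  fun _ ⟨A, B, hA, hB, hX⟩ => ⟨A, B, h _ hA, h' _ hB, hX⟩

theorem extensionsOf_extensionsOf_le (𝒰 𝒱 𝒲 : ObjectProperty C) :
    extensionsOf (extensionsOf 𝒰 𝒱) 𝒲 ≤ extensionsOf 𝒰 (extensionsOf 𝒱 𝒲) := by
  rintro X ⟨A, B, ⟨U, V, hU, hV, hA⟩, hB, hX⟩
  obtain ⟨Y, hXY, hY⟩ := hA.exists_cokernel_comp hX
  exact ⟨U, Y, hU, ⟨V, B, hV, hB, hY⟩, hXY⟩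

theorem extensionsOf_retractClosure_right_le (𝒰 𝒱 : ObjectProperty C) :
    extensionsOf 𝒰 𝒱.retractClosure ≤ (extensionsOf 𝒰 𝒱).retractClosure := by
  rintro X ⟨A, B, hA, ⟨B', hB', ⟨r⟩⟩, hX⟩
  obtain ⟨X', hX', r'⟩ := hX.exists_retract_of_right r
  exact ⟨X', ⟨A, B', hA, hB', hX'⟩, r'⟩

theorem extensionsOf_retractClosure_left_le (𝒰 𝒱 : ObjectProperty C) :
    extensionsOf 𝒰.retractClosure 𝒱 ≤ (extensionsOf 𝒰 𝒱).retractClosure := by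
  rintro X ⟨A, B, ⟨A', hA', ⟨r⟩⟩, hB, hX⟩
  obtain ⟨X', hX', r'⟩ := hX.exists_retract_of_left r
  exact ⟨X', ⟨A', B, hA', hB, hX'⟩, r'⟩

theorem extensionsOf_retractClosure_le (𝒰 𝒱 : ObjectProperty C) :
    extensionsOf 𝒰.retractClosure 𝒱.retractClosure ≤ (extensionsOf 𝒰 𝒱).retractClosure :=
  (extensionsOf_retractClosure_left_le _ _).trans ((ObjectProperty.retractClosure_le_iff _ _).2
    (extensionsOf_retractClosure_right_le _ _))

/-- The iterated extensions of `k` objects of `add V`, that is, the objects with a filtration of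
length `k` whose factors lie in `add V`. This is `extPower V k` before passing to summands. -/
def layers (V : C) : ℕ → ObjectProperty C
  | 0 => fun X => IsZero X
  | k + 1 => extensionsOf (addObj V) (layers V k)

instance (V : C) (k : ℕ) : (layers V k).IsClosedUnderIsomorphisms := by
  cases k with
  | zero => exact ⟨fun e hX => hX.of_iso e.symm⟩
  | succ k => exact inferInstanceAs (extensionsOf _ _).IsClosedUnderIsomorphisms

theorem layers_of_isZero {V Z : C} (hZ : IsZero Z) (k : ℕ) : layers V k Z := by
  induction k with
  | zero => exact hZ
  | succ k ih => exact ⟨Z, Z, addClosure_of_isZero hZ, ih, .of_isZero_left hZ Z⟩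

theorem layers_biprod {V X Y : C} {k : ℕ} (hX : layers V k X) (hY : layers V k Y) :
    layers V k (X ⊞ Y) := by
  induction k generalizing X Y with
  | zero => exact (biprod_isZero_iff X Y).2 ⟨hX, hY⟩
  | succ k ih =>
    obtain ⟨A, B, hA, hB, h⟩ := hX
    obtain ⟨A', B', hA', hB', h'⟩ := hY
    exact ⟨_, _, addClosure_biprod hA hA', ih hB hB', h.biprod h'⟩

theorem layers_mono {V W : C} (h : addObj V ≤ addObj W) (k : ℕ) : layers V k ≤ layers W k := by
  induction k with
  | zero => exact le_rfl
  | succ k ih => exact extensionsOf_mono h ih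

theorem addObj_le_layers_one (V : C) : addObj V ≤ layers V 1 := fun X hX =>
  ⟨X, 0, hX, isZero_zero C, .of_isZero_right (isZero_zero C) X⟩

theorem layers_one_le_addObj (V : C) : layers V 1 ≤ addObj V := by
  rintro X ⟨A, B, hA, hB, h⟩
  obtain ⟨e⟩ := h.nonempty_iso_of_isZero_right hB
  exact (addObj V).prop_of_iso e hA

theorem extensionsOf_layers_le (V : C) (a b : ℕ) :
    extensionsOf (layers V a) (layers V b) ≤ layers V (a + b) := by
  induction a with
  | zero =>
    rintro X ⟨A, B, hA, hB, h⟩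
    obtain ⟨e⟩ := h.nonempty_iso_of_isZero_left hA
    rw [zero_add]
    exact (layers V b).prop_of_iso e.symm hB
  | succ a ih =>
    rw [Nat.succ_add]
    exact (extensionsOf_extensionsOf_le _ _ _).trans (extensionsOf_mono le_rfl ih)

/-! ### Extension dimension -/

theorem extProduct_eq_addClosure_extensionsOf (𝒰 𝒱 : ObjectProperty C) :
    extProduct 𝒰 𝒱 = addClosure (extensionsOf 𝒰 𝒱) := by
  refine congrArg addClosure (funext fun X => propext ⟨?_, ?_⟩)
  · rintro ⟨S, hS, h₁, h₃, ⟨e⟩⟩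
    exact ⟨_, _, h₁, h₃, (IsExtension.of_shortExact hS).of_iso (.refl _) e (.refl _)⟩
  · rintro ⟨A, B, hA, hB, f, g, w, h⟩
    exact ⟨_, h, hA, hB, ⟨.refl _⟩⟩

theorem addClosure_le_retractClosure_layers {𝒰 : ObjectProperty C} {V : C} {k : ℕ}
    (h : 𝒰 ≤ (layers V k).retractClosure) : addClosure 𝒰 ≤ (layers V k).retractClosure := by
  refine addClosure_le h (fun hX => ObjectProperty.le_retractClosure _ _ (layers_of_isZero hX k)) ?_
  rintro X Y ⟨X', hX, ⟨r⟩⟩ ⟨Y', hY, ⟨s⟩⟩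
  exact ⟨X' ⊞ Y', layers_biprod hX hY, ⟨⟨biprod.map r.i s.i, biprod.map r.r s.r, by ext <;> simp⟩⟩⟩

theorem extPower_succ_eq_retractClosure_layers (T : C) (k : ℕ) :
    extPower T (k + 1) = (layers T (k + 1)).retractClosure := by
  induction k with
  | zero =>
    change addObj T = (layers T 1).retractClosure
    exact le_antisymm ((addObj_le_layers_one T).trans (ObjectProperty.le_retractClosure _))
      ((ObjectProperty.retractClosure_le_iff _ _).2 (layers_one_le_addObj T))
  | succ k ih =>
    have hk : extPower T (k + 2) = addClosure (extensionsOf (addObj T) (extPower T (k + 1))) :=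
      extProduct_eq_addClosure_extensionsOf _ _
    rw [hk, ih]
    refine le_antisymm (addClosure_le_retractClosure_layers
      (extensionsOf_retractClosure_right_le _ _)) ((ObjectProperty.retractClosure_le_iff _ _).2 ?_)
    exact (extensionsOf_mono le_rfl (ObjectProperty.le_retractClosure _)).trans (le_addClosure _)

theorem extensionsOf_extPower_le (T : C) (a b : ℕ) :
    extensionsOf (extPower T (a + 1)) (extPower T (b + 1)) ≤ extPower T ((a + 1 + b) + 1) := by
  simp only [extPower_succ_eq_retractClosure_layers]
  exact (extensionsOf_retractClosure_le _ _).trans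
    (ObjectProperty.monotone_retractClosure (extensionsOf_layers_le T (a + 1) (b + 1)))

end Abelian

section ExactFunctor

variable {C D : Type u} [Category.{v} C] [Category.{v} D] [Abelian C] [Abelian D]

theorem addClosure_le_inverseImage (F : C ⥤ D) [F.Additive] {𝒰 : ObjectProperty C}
    {𝒱 : ObjectProperty D} (h : 𝒰 ≤ 𝒱.inverseImage F) :
    addClosure 𝒰 ≤ (addClosure 𝒱).inverseImage F := by
  intro X hX
  obtain ⟨ι, _, f, a, b, hf, hs⟩ := addClosure_iff.1 hX
  refine addClosure_iff.2 ⟨ι, inferInstance, fun i => F.obj (f i), fun i => F.map (a i),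
    fun i => F.map (b i), fun i => h _ (hf i), ?_⟩
  simpa only [F.map_sum, F.map_comp, F.map_id] using congrArg F.map hs

theorem addObj_le_inverseImage (F : C ⥤ D) [F.Additive] (T : C) :
    addObj T ≤ (addObj (F.obj T)).inverseImage F :=
  addClosure_le_inverseImage F
    (ObjectProperty.singleton_le_iff.2 ((ObjectProperty.singleton_iff _ _).2 rfl))

variable (F : C ⥤ D) [F.Additive] [PreservesFiniteLimits F] [PreservesFiniteColimits F]

theorem IsExtension.map {A X B : C} (h : IsExtension A X B) :
    IsExtension (F.obj A) (F.obj X) (F.obj B) :=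
  have ⟨_, _, _, h⟩ := h
  of_shortExact (h.map_of_exact F)

theorem layers_le_inverseImage (V : C) (k : ℕ) :
    layers V k ≤ (layers (F.obj V) k).inverseImage F := by
  induction k with
  | zero => exact fun X hX => F.map_isZero hX
  | succ k ih =>
    rintro X ⟨A, B, hA, hB, h⟩
    exact ⟨_, _, addObj_le_inverseImage F V _ hA, ih _ hB, h.map F⟩

theorem extPower_succ_le_inverseImage (T : C) (k : ℕ) :
    extPower T (k + 1) ≤ (extPower (F.obj T) (k + 1)).inverseImage F := by
  simp only [extPower_succ_eq_retractClosure_layers]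
  rintro X ⟨Y, hY, ⟨r⟩⟩
  exact ⟨F.obj Y, layers_le_inverseImage F T _ _ hY, ⟨r.map F⟩⟩

theorem extensionDimension_le_of_section (G : D ⥤ C) (e : G ⋙ F ≅ 𝟭 D) :
    extensionDimension D ≤ extensionDimension C := by
  refine le_iInf₂ fun n ⟨T, hT⟩ => iInf₂_le n ⟨F.obj T, fun X => ?_⟩
  have hX := extPower_succ_le_inverseImage F T n _ (hT (G.obj X))
  rw [extPower_succ_eq_retractClosure_layers] at hX ⊢
  exact ObjectProperty.prop_of_iso _ (e.app X) hX

theorem extensionDimension_add_one_le_of_extension (A B : D → C)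
    (h : ∀ X, IsExtension (F.obj (A X)) X (F.obj (B X))) :
    extensionDimension D + 1 ≤ (2 : ℕ) * (extensionDimension C + 1) := by
  refine iInf_add_one_le_mul_iInf_add_one two_ne_zero ?_
  rintro m l hl ⟨T, hT⟩
  refine ⟨F.obj T, fun X => ?_⟩
  rw [show l = m + 1 + m by lia]
  exact extensionsOf_extPower_le _ m m _ ⟨_, _, extPower_succ_le_inverseImage F T m _ (hT _),
    extPower_succ_le_inverseImage F T m _ (hT _), h X⟩

end ExactFunctor

/-! ### Syzygies -/

section Syzygy

variable {C : Type u} [Category.{v} C] [Abelian C]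

attribute [local instance] Abelian.hasFiniteBiproducts

open scoped ZeroObject

namespace IsExtension

theorem nonempty_iso_biprod {A X B : C} (h : IsExtension A X B) [Projective B] :
    Nonempty (X ≅ A ⊞ B) := by
  obtain ⟨f, g, w, h⟩ := h
  exact ⟨(ShortComplex.ShortExact.splittingOfProjective h).isoBinaryBiproduct⟩

theorem rotate {A X B K P : C} (h : IsExtension A X B) (h' : IsExtension K P B) [Projective P] :
    IsExtension K (A ⊞ P) X := by
  obtain ⟨f, g, w, h⟩ := h
  obtain ⟨f', g', w', h'⟩ := h'
  have sq := IsPullback.of_hasPullback g g'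
  obtain ⟨k, hk, -, h₁⟩ := exists_shortExact_of_isPullback h sq
  obtain ⟨k', hk', -, h₂⟩ := exists_shortExact_of_isPullback h' sq.flip
  obtain ⟨e⟩ := nonempty_iso_biprod ⟨_, _, _, h₁⟩
  exact of_iso ⟨_, _, _, h₂⟩ (.refl _) e (.refl _)

theorem horseshoe {A X B K P L Q : C} (h : IsExtension A X B) (hA : IsExtension K P A)
    (hB : IsExtension L Q B) [Projective Q] :
    ∃ Z : C, IsExtension Z (P ⊞ Q) X ∧ IsExtension K Z L := by
  have hAQ : IsExtension K (P ⊞ Q) (A ⊞ Q) :=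
    (hA.biprod (of_isZero_left (isZero_zero C) Q)).of_iso
      (isoBiprodZero (isZero_zero C)).symm (.refl _) (.refl _)
  obtain ⟨Z, hZ, hX⟩ := hAQ.exists_kernel_comp (h.rotate hB)
  exact ⟨Z, hX, hZ⟩

end IsExtension

theorem nonempty_retract_syzygy {X Y K P L Q : C} (r : Retract X Y) (hX : IsExtension K P X)
    (hY : IsExtension L Q Y) [Projective P] [Projective Q] : Nonempty (Retract K (L ⊞ P)) := by
  obtain ⟨f, g, w, hX⟩ := hX
  obtain ⟨f', g', w', hY⟩ := hY
  have : Epi g := hX.epi_g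
  have : Epi g' := hY.epi_g
  have : Mono f := hX.mono_f
  obtain ⟨a, ha⟩ : ∃ a : P ⟶ Q, a ≫ g' = g ≫ r.i := ⟨_, Projective.factorThru_comp _ _⟩
  obtain ⟨b, hb⟩ : ∃ b : Q ⟶ P, b ≫ g = g' ≫ r.r := ⟨_, Projective.factorThru_comp _ _⟩
  obtain ⟨a', ha'⟩ : ∃ a' : K ⟶ L, a' ≫ f' = f ≫ a :=
    exists_lift_of_shortExact hY (f ≫ a) (by simp [ha, reassoc_of% w])
  obtain ⟨b', hb'⟩ : ∃ b' : L ⟶ K, b' ≫ f = f' ≫ b :=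
    exists_lift_of_shortExact hX (f' ≫ b) (by simp [hb, reassoc_of% w'])
  obtain ⟨c, hc⟩ : ∃ c : P ⟶ K, c ≫ f = 𝟙 P - a ≫ b :=
    exists_lift_of_shortExact hX (𝟙 P - a ≫ b) (by simp [hb, reassoc_of% ha])
  refine ⟨⟨biprod.lift a' f, biprod.desc b' c, ?_⟩⟩
  rw [biprod.lift_desc, ← cancel_mono f, Preadditive.add_comp, Category.assoc, Category.assoc, hb',
    hc, reassoc_of% ha', Preadditive.comp_sub]
  simp

/-- The class of cokernels `X` of monomorphisms from an object of `𝒦` to an object of `ℱ`: those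
in a short exact sequence `0 → K → F → X → 0`. -/
def cokernelsOf (𝒦 ℱ : ObjectProperty C) : ObjectProperty C := fun X =>
  ∃ K F : C, 𝒦 K ∧ ℱ F ∧ IsExtension K F X

instance (𝒦 ℱ : ObjectProperty C) : (cokernelsOf 𝒦 ℱ).IsClosedUnderIsomorphisms where
  of_iso := fun e ⟨K, F, hK, hF, h⟩ => ⟨K, F, hK, hF, h.of_iso (.refl _) (.refl _) e⟩

theorem cokernelsOf_mono {𝒦 𝒦' ℱ ℱ' : ObjectProperty C} (h : 𝒦 ≤ 𝒦') (h' : ℱ ≤ ℱ') :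
    cokernelsOf 𝒦 ℱ ≤ cokernelsOf 𝒦' ℱ' :=
  fun _ ⟨K, F, hK, hF, hX⟩ => ⟨K, F, h _ hK, h' _ hF, hX⟩

theorem cokernelsOf_cokernelsOf_le (𝒦 𝒰 ℱ : ObjectProperty C) :
    cokernelsOf 𝒦 (cokernelsOf 𝒰 ℱ) ≤ cokernelsOf (extensionsOf 𝒰 𝒦) ℱ := by
  rintro X ⟨K, Y, hK, ⟨U, F, hU, hF, hY⟩, hX⟩
  obtain ⟨Z, hZ, hX⟩ := hY.exists_kernel_comp hX
  exact ⟨Z, F, ⟨U, K, hU, hK, hZ⟩, hF, hX⟩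

/-- The class of objects which have a first syzygy in `𝒰`. -/
abbrev withSyzygyIn (𝒰 : ObjectProperty C) : ObjectProperty C :=
  cokernelsOf 𝒰 (isProjective C)

theorem iterate_withSyzygyIn_mono {𝒰 𝒱 : ObjectProperty C} (h : 𝒰 ≤ 𝒱) (t : ℕ) :
    withSyzygyIn^[t] 𝒰 ≤ withSyzygyIn^[t] 𝒱 :=
  Monotone.iterate (fun _ _ h => cokernelsOf_mono h le_rfl) t h

instance (𝒰 : ObjectProperty C) [𝒰.IsClosedUnderIsomorphisms] (t : ℕ) :
    (withSyzygyIn^[t] 𝒰).IsClosedUnderIsomorphisms := by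
  cases t with
  | zero => assumption
  | succ t =>
    rw [Function.iterate_succ_apply']
    infer_instance

theorem iterate_withSyzygyIn_iff {𝒰 : ObjectProperty C} [𝒰.IsClosedUnderIsomorphisms] {t : ℕ}
    {X : C} : (withSyzygyIn^[t] 𝒰) X ↔ ∃ K, IsSyzygy t X K ∧ 𝒰 K := by
  induction t generalizing X with
  | zero => exact ⟨fun h => ⟨X, ⟨.refl _⟩, h⟩, fun ⟨K, ⟨e⟩, h⟩ => 𝒰.prop_of_iso e h⟩
  | succ t ih =>
    rw [Function.iterate_succ_apply']
    constructor
    · rintro ⟨Y, P, hY, hP, f, g, w, h⟩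
      obtain ⟨K, hK, hK'⟩ := ih.1 hY
      exact ⟨K, ⟨_, h, hP, ⟨.refl _⟩, hK⟩, hK'⟩
    · rintro ⟨K, ⟨S, hS, hP, ⟨e⟩, hK⟩, hK'⟩
      exact ⟨S.X₁, S.X₂, ih.2 ⟨K, hK, hK'⟩, hP,
        (IsExtension.of_shortExact hS).of_iso (.refl _) (.refl _) e⟩

theorem extensionsOf_withSyzygyIn_le (𝒰 𝒱 : ObjectProperty C) :
    extensionsOf (withSyzygyIn 𝒰) (withSyzygyIn 𝒱) ≤ withSyzygyIn (extensionsOf 𝒰 𝒱) := by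
  rintro X ⟨A, B, ⟨K, P, hK, hP, hA⟩, ⟨L, Q, hL, hQ, hB⟩, h⟩
  have : Projective P := hP
  have : Projective Q := hQ
  obtain ⟨Z, hX, hZ⟩ := h.horseshoe hA hB
  exact ⟨Z, P ⊞ Q, ⟨K, L, hK, hL, hZ⟩, inferInstanceAs (Projective (P ⊞ Q)), hX⟩

theorem extensionsOf_iterate_withSyzygyIn_le (𝒰 𝒱 : ObjectProperty C) (t : ℕ) :
    extensionsOf (withSyzygyIn^[t] 𝒰) (withSyzygyIn^[t] 𝒱) ≤
      withSyzygyIn^[t] (extensionsOf 𝒰 𝒱) := by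
  induction t with
  | zero => exact le_rfl
  | succ t ih =>
    simp only [Function.iterate_succ_apply']
    exact (extensionsOf_withSyzygyIn_le _ _).trans (cokernelsOf_mono ih le_rfl)

theorem hasAddResolution_succ_eq_cokernelsOf (U : C) (m : ℕ) :
    HasAddResolution U (m + 1) = cokernelsOf (HasAddResolution U m) (addObj U) := by
  refine funext fun X => propext ⟨?_, ?_⟩
  · rintro ⟨S, hS, h₂, ⟨e⟩, h₁⟩
    exact ⟨_, _, h₁, h₂, (IsExtension.of_shortExact hS).of_iso (.refl _) (.refl _) e⟩
  · rintro ⟨K, A, hK, hA, f, g, w, h⟩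
    exact ⟨_, h, hA, ⟨.refl _⟩, hK⟩

instance (U : C) (m : ℕ) :
    ObjectProperty.IsClosedUnderIsomorphisms (C := C) (HasAddResolution U m) := by
  cases m with
  | zero => exact inferInstanceAs (addObj U).IsClosedUnderIsomorphisms
  | succ m =>
    rw [hasAddResolution_succ_eq_cokernelsOf]
    infer_instance

theorem hasAddResolution_mono {V W : C} (h : addObj V ≤ addObj W) (m : ℕ) :
    HasAddResolution V m ≤ HasAddResolution W m := by
  induction m with
  | zero => exact h
  | succ m ih =>
    simp only [hasAddResolution_succ_eq_cokernelsOf]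
    exact cokernelsOf_mono ih h

theorem isIgusaTodorovCategory_iff {m t : ℕ} : IsIgusaTodorovCategory C m t ↔
    ∃ U : C, ∀ X : C, (withSyzygyIn^[t] (HasAddResolution U m)) X := by
  simp only [iterate_withSyzygyIn_iff (𝒰 := HasAddResolution _ m), IsIgusaTodorovCategory]

theorem addObj_le_isProjective (P : C) [Projective P] : addObj P ≤ isProjective C := by
  have : (isProjective C).IsStableUnderRetracts := ⟨fun r h => r.projective⟩
  exact addClosure_le (ObjectProperty.singleton_le_iff.2 (inferInstanceAs (Projective P)))
    (fun h => h.projective) fun {X Y} (_ : Projective X) (_ : Projective Y) =>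
      inferInstanceAs (Projective (X ⊞ Y))

/-- `G` is projective and every object is a quotient of a direct summand of a finite direct sum of
copies of `G`. -/
structure IsProjectiveGenerator (G : C) : Prop where
  projective : Projective G
  exists_epi : ∀ X : C, ∃ (P : C) (p : P ⟶ X), addObj G P ∧ Epi p

namespace IsProjectiveGenerator

variable {G : C} (hG : IsProjectiveGenerator G)
include hG

theorem addObj_of_projective (P : C) [Projective P] : addObj G P := by
  obtain ⟨Q, p, hQ, _⟩ := hG.exists_epi P
  exact (addObj G).prop_of_retract ⟨Projective.factorThru (𝟙 P) p, p, by simp⟩ hQ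

theorem preservesProjectiveObjects {D : Type u} [Category.{v} D] [Abelian D] (F : C ⥤ D)
    [F.Additive] [Projective (F.obj G)] : F.PreservesProjectiveObjects where
  projective_obj {P} _ := addObj_le_isProjective (F.obj G) _
    (addObj_le_inverseImage F G _ (hG.addObj_of_projective P))

theorem exists_syzygy (X : C) : ∃ K P : C, Projective P ∧ IsExtension K P X := by
  obtain ⟨P, p, hP, _⟩ := hG.exists_epi X
  have := hG.projective
  exact ⟨kernel p, P, addObj_le_isProjective G _ hP, kernel.ι p, p, by simp,
    shortExact_of_forall_exists_lift _ _ _ fun k hk => ⟨kernel.lift p k hk, by simp⟩⟩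

theorem addObj_of_isExtension {W X Y K P : C} (hGW : addObj G ≤ addObj W) (r : Retract X Y)
    (hY : withSyzygyIn (addObj W) Y) (hX : IsExtension K P X) [Projective P] : addObj W K := by
  obtain ⟨L, Q, hL, hQ, hY⟩ := hY
  have : Projective Q := hQ
  obtain ⟨s⟩ := nonempty_retract_syzygy r hX hY
  exact (addObj W).prop_of_retract s
    (addClosure_biprod hL (hGW _ (hG.addObj_of_projective P)))

theorem exists_forall_addObj_syzygy (V : C) : ∃ W : C, ∀ {X K P : C}, addObj V X →
    Projective P → IsExtension K P X → addObj W K := by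
  obtain ⟨K₀, P₀, hP₀, hV⟩ := hG.exists_syzygy V
  have hGW : addObj G ≤ addObj (K₀ ⊞ G) := addObj_le_biprod_right K₀ G
  have : (withSyzygyIn (addObj (K₀ ⊞ G))).IsStableUnderRetracts := ⟨fun {X Y} r hY => by
    obtain ⟨K, P, hP, hX⟩ := hG.exists_syzygy X
    exact ⟨K, P, hG.addObj_of_isExtension hGW r hY hX, hP, hX⟩⟩
  have key : addObj V ≤ withSyzygyIn (addObj (K₀ ⊞ G)) := by
    refine addClosure_le (ObjectProperty.singleton_le_iff.2
      ⟨K₀, P₀, addObj_le_biprod_left _ _ _ (addObj_self _), hP₀, hV⟩) ?_ ?_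
    · exact fun {X} hX => ⟨X, X, addClosure_of_isZero hX, hX.projective, .of_isZero_left hX X⟩
    · rintro X Y ⟨K, P, hK, hP, hX⟩ ⟨L, Q, hL, hQ, hY⟩
      have : Projective P := hP
      have : Projective Q := hQ
      exact ⟨_, _, addClosure_biprod hK hL, inferInstanceAs (Projective (P ⊞ Q)), hX.biprod hY⟩
  exact ⟨K₀ ⊞ G, fun hX hP h => hG.addObj_of_isExtension hGW (.refl _) (key _ hX) h⟩

theorem exists_addObj_le_withSyzygyIn (V : C) : ∃ W : C, addObj V ≤ withSyzygyIn (addObj W) := by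
  obtain ⟨W, hW⟩ := hG.exists_forall_addObj_syzygy V
  refine ⟨W, fun X hX => ?_⟩
  obtain ⟨K, P, hP, h⟩ := hG.exists_syzygy X
  exact ⟨K, P, hW hX hP h, hP, h⟩

theorem exists_layers_le_iterate_withSyzygyIn (V : C) (k s : ℕ) :
    ∃ W : C, layers V k ≤ withSyzygyIn^[s] (layers W k) := by
  induction s with
  | zero => exact ⟨V, le_rfl⟩
  | succ s ih =>
    obtain ⟨W, hW⟩ := ih
    obtain ⟨W', hW'⟩ := hG.exists_addObj_le_withSyzygyIn W
    refine ⟨W', hW.trans ?_⟩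
    rw [Function.iterate_succ_apply]
    refine iterate_withSyzygyIn_mono ?_ s
    clear hW
    induction k with
    | zero => exact fun X hX => ⟨X, X, hX, hX.projective, .of_isZero_left hX X⟩
    | succ k ih => exact (extensionsOf_mono hW' ih).trans (extensionsOf_withSyzygyIn_le _ _)

theorem exists_hasAddResolution_le_withSyzygyIn (U : C) (m : ℕ) :
    ∃ W : C, HasAddResolution U m ≤ withSyzygyIn (HasAddResolution W m) := by
  obtain ⟨W, hW⟩ := hG.exists_forall_addObj_syzygy U
  refine ⟨W, ?_⟩
  induction m with
  | zero =>
    intro X hX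
    obtain ⟨K, P, hP, h⟩ := hG.exists_syzygy X
    exact ⟨K, P, hW hX hP h, hP, h⟩
  | succ m ih =>
    simp only [hasAddResolution_succ_eq_cokernelsOf]
    rintro X ⟨K, A, hK, hA, hX⟩
    obtain ⟨L, P, hL, hP, hKL⟩ := ih _ hK
    obtain ⟨Y, Q, hQ, hY⟩ := hG.exists_syzygy X
    have : Projective P := hP
    obtain ⟨Z, hZ, hYZ⟩ := hX.horseshoe hKL hY
    exact ⟨Y, Q, ⟨L, Z, hL, hW hA inferInstance hZ, hYZ⟩, hQ, hY⟩

theorem exists_layers_le_hasAddResolution (V : C) (m : ℕ) :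
    ∃ W : C, layers V (m + 1) ≤ HasAddResolution W m := by
  induction m with
  | zero => exact ⟨V, layers_one_le_addObj V⟩
  | succ m ih =>
    obtain ⟨W, hW⟩ := ih
    obtain ⟨W', hW'⟩ := hG.exists_hasAddResolution_le_withSyzygyIn W m
    refine ⟨(V ⊞ G) ⊞ W', ?_⟩
    rw [hasAddResolution_succ_eq_cokernelsOf]
    rintro X ⟨A, B, hA, hB, h⟩
    obtain ⟨K, P, hK, hP, hBK⟩ := hW' _ (hW _ hB)
    have : Projective P := hP
    refine ⟨K, A ⊞ P, hasAddResolution_mono (addObj_le_biprod_right _ _) m _ hK,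
      addObj_le_biprod_left _ _ _ ?_, h.rotate hBK⟩
    exact addClosure_biprod (addObj_le_biprod_left _ _ _ hA)
      (addObj_le_biprod_right _ _ _ (hG.addObj_of_projective P))

end IsProjectiveGenerator

/-! ### Igusa-Todorov distance -/

/-- For some `t` and `V`, all objects of `𝒳` have a `t`-th syzygy which is an iterated extension of
`k` objects of `add V`. Given a projective generator, `C` has Igusa-Todorov distance at most `m`
if and only if this holds for the class of all objects and `k = m + 1`. -/
def HasSyzygyLayers (𝒳 : ObjectProperty C) (k : ℕ) : Prop :=
  ∃ (t : ℕ) (V : C), 𝒳 ≤ withSyzygyIn^[t] (layers V k)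

namespace HasSyzygyLayers

theorem of_le_iterate_withSyzygyIn {𝒳 𝒰 : ObjectProperty C} {k t : ℕ}
    (h : 𝒳 ≤ withSyzygyIn^[t] 𝒰) (h𝒰 : HasSyzygyLayers 𝒰 k) : HasSyzygyLayers 𝒳 k := by
  obtain ⟨s, V, hV⟩ := h𝒰
  refine ⟨t + s, V, h.trans ?_⟩
  rw [Function.iterate_add_apply]
  exact iterate_withSyzygyIn_mono hV t

theorem of_le {𝒳 𝒰 : ObjectProperty C} {k : ℕ} (h : 𝒳 ≤ 𝒰) (h𝒰 : HasSyzygyLayers 𝒰 k) :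
    HasSyzygyLayers 𝒳 k :=
  of_le_iterate_withSyzygyIn (t := 0) h h𝒰

variable {G : C} (hG : IsProjectiveGenerator G)
include hG

theorem exists_le_iterate_add {𝒳 : ObjectProperty C} {k t : ℕ} {V : C}
    (h : 𝒳 ≤ withSyzygyIn^[t] (layers V k)) (s : ℕ) :
    ∃ W : C, 𝒳 ≤ withSyzygyIn^[t + s] (layers W k) := by
  obtain ⟨W, hW⟩ := hG.exists_layers_le_iterate_withSyzygyIn V k s
  refine ⟨W, h.trans ?_⟩
  rw [Function.iterate_add_apply]
  exact iterate_withSyzygyIn_mono hW t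

/-- The covering class `ℱ` is taken one syzygy further than `𝒦`, so that the two syzygies combine
to a syzygy of the cokernel. -/
theorem cokernelsOf {𝒦 ℱ : ObjectProperty C} {a b : ℕ} (h𝒦 : HasSyzygyLayers 𝒦 a)
    (hℱ : HasSyzygyLayers ℱ b) : HasSyzygyLayers (cokernelsOf 𝒦 ℱ) (a + b) := by
  obtain ⟨s, V, h𝒦⟩ := h𝒦
  obtain ⟨t, W, hℱ⟩ := hℱ
  obtain ⟨V', h𝒦⟩ := exists_le_iterate_add hG h𝒦 t
  obtain ⟨W', hℱ⟩ := exists_le_iterate_add hG hℱ (s + 1)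
  rw [← add_assoc, add_comm t s, Function.iterate_succ_apply'] at hℱ
  refine ⟨s + t + 1, W' ⊞ V', (cokernelsOf_mono h𝒦 hℱ).trans
    ((cokernelsOf_cokernelsOf_le _ _ _).trans ?_)⟩
  rw [Function.iterate_succ_apply']
  refine cokernelsOf_mono ((extensionsOf_iterate_withSyzygyIn_le _ _ _).trans
    (iterate_withSyzygyIn_mono ?_ _)) le_rfl
  rw [add_comm a b]
  exact (extensionsOf_mono (layers_mono (addObj_le_biprod_left _ _) _)
    (layers_mono (addObj_le_biprod_right _ _) _)).trans (extensionsOf_layers_le _ _ _)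

theorem hasAddResolution (U : C) (m : ℕ) : HasSyzygyLayers (HasAddResolution U m) (m + 1) := by
  induction m with
  | zero => exact ⟨0, U, addObj_le_layers_one U⟩
  | succ m ih =>
    rw [hasAddResolution_succ_eq_cokernelsOf]
    exact ih.cokernelsOf hG ⟨0, U, addObj_le_layers_one U⟩

theorem top_iff_exists_isIgusaTodorovCategory {m : ℕ} :
    HasSyzygyLayers (⊤ : ObjectProperty C) (m + 1) ↔ ∃ t, IsIgusaTodorovCategory C m t := by
  simp only [isIgusaTodorovCategory_iff]
  constructor
  · rintro ⟨t, V, hV⟩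
    obtain ⟨W, hW⟩ := hG.exists_layers_le_hasAddResolution V m
    exact ⟨t, W, fun X => iterate_withSyzygyIn_mono hW t _ (hV X trivial)⟩
  · rintro ⟨t, U, hU⟩
    exact of_le_iterate_withSyzygyIn (fun X _ => hU X) (hasAddResolution hG U m)

end HasSyzygyLayers

end Syzygy

section IgusaTodorov

variable {C D : Type u} [Category.{v} C] [Category.{v} D] [Abelian C] [Abelian D]
  (F : C ⥤ D) [F.Additive] [PreservesFiniteLimits F] [PreservesFiniteColimits F]

theorem hasAddResolution_le_inverseImage (U : C) (m : ℕ) :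
    HasAddResolution U m ≤ ObjectProperty.inverseImage (HasAddResolution (F.obj U) m) F := by
  induction m with
  | zero => exact addObj_le_inverseImage F U
  | succ m ih =>
    simp only [hasAddResolution_succ_eq_cokernelsOf]
    rintro X ⟨K, A, hK, hA, hX⟩
    exact ⟨_, _, ih _ hK, addObj_le_inverseImage F U _ hA, hX.map F⟩

variable [F.PreservesProjectiveObjects]

theorem iterate_withSyzygyIn_le_inverseImage {𝒰 : ObjectProperty C} {𝒱 : ObjectProperty D}
    (h : 𝒰 ≤ 𝒱.inverseImage F) (t : ℕ) :
    withSyzygyIn^[t] 𝒰 ≤ ObjectProperty.inverseImage (withSyzygyIn^[t] 𝒱) F := by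
  induction t with
  | zero => exact h
  | succ t ih =>
    simp only [Function.iterate_succ_apply']
    rintro X ⟨K, P, hK, hP, hX⟩
    have : Projective P := hP
    exact ⟨_, _, ih _ hK, F.projective_obj P, hX.map F⟩

theorem HasSyzygyLayers.strictMap {𝒳 : ObjectProperty C} {k : ℕ} (h : HasSyzygyLayers 𝒳 k) :
    HasSyzygyLayers (𝒳.strictMap F) k := by
  obtain ⟨t, V, hV⟩ := h
  refine ⟨t, F.obj V, ?_⟩
  rintro _ ⟨X, hX⟩
  exact iterate_withSyzygyIn_le_inverseImage F (layers_le_inverseImage F V k) t _ (hV _ hX)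

theorem igusaTodorovDistance_le_of_section (G : D ⥤ C) (e : G ⋙ F ≅ 𝟭 D) :
    igusaTodorovDistance D ≤ igusaTodorovDistance C := by
  refine le_iInf₂ fun m ⟨t, h⟩ => iInf₂_le m ⟨t, ?_⟩
  obtain ⟨U, hU⟩ := isIgusaTodorovCategory_iff.1 h
  exact isIgusaTodorovCategory_iff.2 ⟨F.obj U, fun X => ObjectProperty.prop_of_iso _ (e.app X)
    (iterate_withSyzygyIn_le_inverseImage F (hasAddResolution_le_inverseImage F U m) t _
      (hU (G.obj X)))⟩

theorem igusaTodorovDistance_add_one_le_of_nilpotent {P : C} (hP : IsProjectiveGenerator P)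
    {Q : D} (hQ : IsProjectiveGenerator Q) (E : D → C) (G : D → D)
    (h : ∀ X, IsExtension (G X) (F.obj (E X)) X) {n : ℕ} (hn : n ≠ 0)
    (hG : ∀ X, IsZero (G^[n] X)) :
    igusaTodorovDistance D + 1 ≤ n * (igusaTodorovDistance C + 1) := by
  refine iInf_add_one_le_mul_iInf_add_one hn fun m l hl hm => ?_
  have hF : HasSyzygyLayers ((⊤ : ObjectProperty C).strictMap F) (m + 1) :=
    ((HasSyzygyLayers.top_iff_exists_isIgusaTodorovCategory hP).2 hm).strictMap F
  have hIter : ∀ j, HasSyzygyLayers (fun X => IsZero (G^[j] X)) (j * (m + 1)) := by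
    intro j
    induction j with
    | zero => exact ⟨0, Q, by rw [Nat.zero_mul]; exact le_rfl⟩
    | succ j ih =>
      rw [Nat.succ_mul]
      exact (ih.cokernelsOf hQ hF).of_le fun X hX => ⟨G X, F.obj (E X), hX, ⟨E X, trivial⟩, h X⟩
  rw [← HasSyzygyLayers.top_iff_exists_isIgusaTodorovCategory hQ, hl]
  exact (hIter n).of_le fun X _ => hG X

end IgusaTodorov

/-! ### Finitely generated modules -/

section FGModuleCat

attribute [local instance] Abelian.hasFiniteBiproducts

section Noetherian

variable {A : Type u} [Ring A] [IsNoetherianRing A]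

theorem shortExact_fgModuleCat_iff (S : ShortComplex (FGModuleCat.{u} A)) :
    S.ShortExact ↔ Function.Injective S.f.hom.hom ∧
      Function.Exact S.f.hom.hom S.g.hom.hom ∧ Function.Surjective S.g.hom.hom := by
  rw [← ShortExact.shortExact_map_iff (forget₂ (FGModuleCat.{u} A) (ModuleCat.{u} A))]
  constructor
  · exact fun h => ⟨h.moduleCat_injective_f,
      (ShortComplex.ShortExact.moduleCat_exact_iff_function_exact _).1 h.exact,
      h.moduleCat_surjective_g⟩
  · rintro ⟨hf, hfg, hg⟩
    have := (ModuleCat.mono_iff_injective (S.map (forget₂ _ (ModuleCat.{u} A))).f).2 hf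
    have := (ModuleCat.epi_iff_surjective (S.map (forget₂ _ (ModuleCat.{u} A))).g).2 hg
    exact ⟨(ShortComplex.ShortExact.moduleCat_exact_iff_function_exact _).2 hfg⟩

theorem injective_of_mono {X Y : FGModuleCat.{u} A} (f : X ⟶ Y) [Mono f] :
    Function.Injective f.hom.hom :=
  (ModuleCat.mono_iff_injective _).1
    (inferInstanceAs (Mono ((forget₂ (FGModuleCat.{u} A) (ModuleCat.{u} A)).map f)))

theorem surjective_of_epi {X Y : FGModuleCat.{u} A} (f : X ⟶ Y) [Epi f] :
    Function.Surjective f.hom.hom :=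
  (ModuleCat.epi_iff_surjective _).1
    (inferInstanceAs (Epi ((forget₂ (FGModuleCat.{u} A) (ModuleCat.{u} A)).map f)))

theorem projective_fgModuleCat (X : FGModuleCat.{u} A) [Module.Projective A X] : Projective X where
  factors f e _ :=
    have ⟨g, hg⟩ := Module.projective_lifting_property e.hom.hom f.hom.hom (surjective_of_epi e)
    ⟨FGModuleCat.ofHom g, FGModuleCat.hom_ext hg⟩

theorem addObj_fgModuleCat_fin_fun (n : ℕ) :
    addObj (FGModuleCat.of A A) (FGModuleCat.of A (Fin n → A)) := by
  refine addClosure_iff.2 ⟨Fin n, inferInstance, fun _ => FGModuleCat.of A A,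
    fun i => FGModuleCat.ofHom (LinearMap.proj i),
    fun i => FGModuleCat.ofHom (LinearMap.single A (fun _ => A) i),
    fun _ => (ObjectProperty.singleton_iff _ _).2 rfl, ?_⟩
  refine FGModuleCat.hom_ext (LinearMap.ext fun x => ?_)
  let evalAt : (FGModuleCat.of A (Fin n → A) ⟶ FGModuleCat.of A (Fin n → A)) →+ (Fin n → A) :=
    { toFun := fun f => f.hom.hom x, map_zero' := rfl, map_add' := fun _ _ => rfl }
  exact (map_sum evalAt _ _).trans (Finset.univ_sum_single x)

end Noetherian

theorem epi_of_surjective {A : Type u} [Ring A] {X Y : FGModuleCat.{u} A} (f : X ⟶ Y)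
    (hf : Function.Surjective f.hom.hom) : Epi f :=
  (forget₂ (FGModuleCat.{u} A) (ModuleCat.{u} A)).epi_of_epi_map
    ((ModuleCat.epi_iff_surjective _).2 hf)

theorem mono_of_injective {A : Type u} [Ring A] {X Y : FGModuleCat.{u} A} (f : X ⟶ Y)
    (hf : Function.Injective f.hom.hom) : Mono f :=
  (forget₂ (FGModuleCat.{u} A) (ModuleCat.{u} A)).mono_of_mono_map
    ((ModuleCat.mono_iff_injective _).2 hf)

theorem isProjectiveGenerator_self (A : Type u) [Ring A] [IsNoetherianRing A] :
    IsProjectiveGenerator (FGModuleCat.of A A) where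
  projective :=
    have : Module.Projective A (FGModuleCat.of A A) := inferInstanceAs (Module.Projective A A)
    projective_fgModuleCat _
  exists_epi X :=
    have ⟨n, f, hf⟩ := Module.Finite.exists_fin' A X
    ⟨_, FGModuleCat.ofHom f, addObj_fgModuleCat_fin_fun n, epi_of_surjective _ hf⟩

end FGModuleCat

section Restriction

variable {A B : Type u} [Ring A] [Ring B]

/-- A `B`-module `X` regarded as an `A`-module along `φ : A →+* B`. -/
noncomputable abbrev restrict (φ : A →+* B) (X : Type u) [AddCommGroup X] [Module B X] :
    ModuleCat.{u} A :=
  (ModuleCat.restrictScalars φ).obj (ModuleCat.of B X)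

instance finite_restrict (φ : A →+* B) [Module.Finite A (restrict φ B)] (X : Type u)
    [AddCommGroup X] [Module B X] [Module.Finite B X] : Module.Finite A (restrict φ X) := by
  let _ : Module A B := Module.compHom B φ
  have : Module.Finite A B := inferInstanceAs (Module.Finite A (restrict φ B))
  have : IsScalarTower A B (restrict φ X) := ⟨fun a b x => mul_smul (φ a) b (show X from x)⟩
  have : Module.Finite B (restrict φ X) := inferInstanceAs (Module.Finite B X)
  exact Module.Finite.trans B _

theorem isNoetherianRing_of_finite_restrict (φ : A →+* B) [IsNoetherianRing A]
    [Module.Finite A (restrict φ B)] : IsNoetherianRing B := by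
  let _ : Module A B := Module.compHom B φ
  have : Module.Finite A B := inferInstanceAs (Module.Finite A (restrict φ B))
  have : IsScalarTower A B B := ⟨fun a b c => mul_assoc (φ a) b c⟩
  exact isNoetherian_of_tower A inferInstance

theorem finite_restrict_of_surjective {φ : A →+* B} (hφ : Function.Surjective φ) :
    Module.Finite A (restrict φ B) :=
  Module.Finite.of_surjective
    ({ toFun := φ, map_add' := map_add φ, map_smul' := fun a b => map_mul φ a b } :
      A →ₗ[A] restrict φ B) hφ

/-- Restriction of scalars along a finite ring homomorphism, as a functor between categories of
finitely generated modules. -/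
noncomputable def restrictFG (φ : A →+* B) [Module.Finite A (restrict φ B)] :
    FGModuleCat.{u} B ⥤ FGModuleCat.{u} A where
  obj X := FGModuleCat.of A (restrict φ X)
  map f := FGModuleCat.ofHom ((ModuleCat.restrictScalars φ).map f.hom).hom

instance (φ : A →+* B) [Module.Finite A (restrict φ B)] : (restrictFG φ).Additive where
  map_add := rfl

/-- If `φ` is a section of `ψ`, then restriction along `φ` is a retraction of restriction along
`ψ`. -/
noncomputable def restrictFGCompIso (φ : A →+* B) (ψ : B →+* A) [Module.Finite A (restrict φ B)]
    [Module.Finite B (restrict ψ A)] (h : ψ.comp φ = RingHom.id A) :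
    restrictFG ψ ⋙ restrictFG φ ≅ 𝟭 (FGModuleCat.{u} A) :=
  NatIso.ofComponents (fun X => (ModuleCat.isFG A).isoMk
    ((ModuleCat.restrictScalarsComp'App φ ψ _ rfl X.obj).symm ≪≫
      ModuleCat.restrictScalarsId'App _ h X.obj)) fun _ => rfl

variable [IsNoetherianRing A] [IsNoetherianRing B]

theorem exact_restrictFG (φ : A →+* B) [Module.Finite A (restrict φ B)] :
    PreservesFiniteLimits (restrictFG φ) ∧ PreservesFiniteColimits (restrictFG φ) :=
  ((Functor.exact_tfae (restrictFG φ)).out 0 3).1 fun S hS => by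
    rw [shortExact_fgModuleCat_iff] at hS ⊢
    exact hS

instance (φ : A →+* B) [Module.Finite A (restrict φ B)] : PreservesFiniteLimits (restrictFG φ) :=
  (exact_restrictFG φ).1

instance (φ : A →+* B) [Module.Finite A (restrict φ B)] : PreservesFiniteColimits (restrictFG φ) :=
  (exact_restrictFG φ).2

theorem preservesProjectiveObjects_restrictFG (φ : A →+* B) [Module.Finite A (restrict φ B)]
    [Module.Projective A (restrict φ B)] : (restrictFG φ).PreservesProjectiveObjects :=
  have : Module.Projective A ((restrictFG φ).obj (FGModuleCat.of B B)) :=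
    inferInstanceAs (Module.Projective A (restrict φ B))
  have := projective_fgModuleCat ((restrictFG φ).obj (FGModuleCat.of B B))
  (isProjectiveGenerator_self B).preservesProjectiveObjects _

end Restriction

/-! ### The two-step filtration of a module by a square-zero ideal -/

section KerAnnihilated

variable {A B : Type u} [Ring A] [Ring B]

/-- The submodule of the elements of `X` annihilated by the kernel of `π`: the lower step of the
filtration of `X`. -/
def kerAnnihilated (π : B →+* A) (X : Type u) [AddCommGroup X] [Module B X] : Submodule B X where
  carrier := {x | ∀ b, π b = 0 → b • x = 0}
  add_mem' hx hy b hb := by rw [smul_add, hx b hb, hy b hb, add_zero]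
  zero_mem' b _ := smul_zero b
  smul_mem' c x hx b hb := by rw [← mul_smul, hx _ (by rw [map_mul, hb, zero_mul])]

theorem kerAnnihilated_le_comap (π : B →+* A) {X Y : Type u} [AddCommGroup X] [Module B X]
    [AddCommGroup Y] [Module B Y] (f : X →ₗ[B] Y) :
    kerAnnihilated π X ≤ (kerAnnihilated π Y).comap f := fun x hx b hb => by
  rw [← map_smul, hx b hb, map_zero]

theorem smul_mem_kerAnnihilated {π : B →+* A} (h : ∀ a b, π a = 0 → π b = 0 → a * b = 0)
    {X : Type u} [AddCommGroup X] [Module B X] {b : B} (hb : π b = 0) (x : X) :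
    b • x ∈ kerAnnihilated π X := fun c hc => by
  rw [← mul_smul, h c b hc hb, zero_smul]

theorem map_smul_eq_smul {ι : A →+* B} {π : B →+* A} (hπ : π.comp ι = RingHom.id A) {X : Type u}
    [AddCommGroup X] [Module B X] (hX : ∀ b, π b = 0 → ∀ x : X, b • x = 0) (b : B) (x : X) :
    ι (π b) • x = b • x := by
  rw [← sub_eq_zero, ← sub_smul]
  exact hX _ (by rw [map_sub, sub_eq_zero]; exact RingHom.congr_fun hπ (π b)) x

theorem smul_quotient_kerAnnihilated_eq_zero {π : B →+* A}
    (h : ∀ a b, π a = 0 → π b = 0 → a * b = 0) {X : Type u} [AddCommGroup X] [Module B X] (b : B)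
    (hb : π b = 0) (x : X ⧸ kerAnnihilated π X) : b • x = 0 := by
  obtain ⟨x, rfl⟩ := Submodule.mkQ_surjective _ x
  rw [← map_smul]
  exact (Submodule.Quotient.mk_eq_zero _).2 (smul_mem_kerAnnihilated h hb x)

variable [IsNoetherianRing B]

/-- The functor sending `X` to its submodule `kerAnnihilated π X`. -/
def kerAnnihilatedFunctor (π : B →+* A) : FGModuleCat.{u} B ⥤ FGModuleCat.{u} B where
  obj X := FGModuleCat.of B (kerAnnihilated π X)
  map f := FGModuleCat.ofHom (f.hom.hom.restrict (kerAnnihilated_le_comap π f.hom.hom))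

instance (π : B →+* A) : (kerAnnihilatedFunctor π).Additive where
  map_add := rfl

/-- The functor sending `X` to its quotient by `kerAnnihilated π X`. -/
def quotientKerAnnihilatedFunctor (π : B →+* A) : FGModuleCat.{u} B ⥤ FGModuleCat.{u} B where
  obj X := FGModuleCat.of B (X ⧸ kerAnnihilated π X)
  map f := FGModuleCat.ofHom
    ((kerAnnihilated π _).mapQ _ f.hom.hom (kerAnnihilated_le_comap π f.hom.hom))
  map_id _ := FGModuleCat.hom_ext (Submodule.mapQ_id _)
  map_comp f g := FGModuleCat.hom_ext (Submodule.mapQ_comp _ _ _ f.hom.hom g.hom.hom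
    (kerAnnihilated_le_comap π f.hom.hom) (kerAnnihilated_le_comap π g.hom.hom))

instance (π : B →+* A) : (quotientKerAnnihilatedFunctor π).Additive where
  map_add := FGModuleCat.hom_ext (Submodule.linearMap_qext _ rfl)

variable (ι : A →+* B) (π : B →+* A) [Module.Finite A (restrict ι B)]
  [Module.Finite B (restrict π A)]

/-- The inclusion of `kerAnnihilated π X` into `X`. The ring `A` acts on the source through
the section `ι` of `π`, and `B` through `π`; this is the original action of `B`. -/
noncomputable def kerAnnihilatedInclusion (hπ : π.comp ι = RingHom.id A) :
    (kerAnnihilatedFunctor π ⋙ restrictFG ι) ⋙ restrictFG π ⟶ 𝟭 (FGModuleCat.{u} B) where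
  app X := FGModuleCat.ofHom
    ({ toFun := fun x => (show kerAnnihilated π X from x).1
       map_add' := fun _ _ => rfl
       map_smul' := fun b x => congrArg Subtype.val
        (map_smul_eq_smul hπ (X := kerAnnihilated π X)
          (fun b hb x => Subtype.ext (x.2 b hb)) b x) } :
      restrict π (restrict ι (kerAnnihilated π X)) →ₗ[B] X)

/-- The projection of `X` to its quotient by `kerAnnihilated π X`, on which `B` acts through
`ι ∘ π` because the kernel of `π` has square zero. -/
noncomputable def kerAnnihilatedProjection (hπ : π.comp ι = RingHom.id A)
    (h : ∀ a b, π a = 0 → π b = 0 → a * b = 0) :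
    𝟭 (FGModuleCat.{u} B) ⟶ (quotientKerAnnihilatedFunctor π ⋙ restrictFG ι) ⋙ restrictFG π where
  app X := FGModuleCat.ofHom
    ({ toFun := fun x => (kerAnnihilated π X).mkQ x
       map_add' := fun _ _ => rfl
       map_smul' := fun b x => (map_smul_eq_smul hπ
        (smul_quotient_kerAnnihilated_eq_zero h) b ((kerAnnihilated π X).mkQ x)).symm } :
      X →ₗ[B] restrict π (restrict ι (X ⧸ kerAnnihilated π X)))

theorem kerAnnihilatedInclusion_comp_projection (hπ : π.comp ι = RingHom.id A)
    (h : ∀ a b, π a = 0 → π b = 0 → a * b = 0) (X : FGModuleCat.{u} B) :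
    (kerAnnihilatedInclusion ι π hπ).app X ≫ (kerAnnihilatedProjection ι π hπ h).app X = 0 := by
  ext x
  exact (Submodule.Quotient.mk_eq_zero _).2 (show kerAnnihilated π X from x).2

theorem shortExact_kerAnnihilated (hπ : π.comp ι = RingHom.id A)
    (h : ∀ a b, π a = 0 → π b = 0 → a * b = 0) (X : FGModuleCat.{u} B) :
    (ShortComplex.mk _ _ (kerAnnihilatedInclusion_comp_projection ι π hπ h X)).ShortExact := by
  rw [shortExact_fgModuleCat_iff]
  refine ⟨fun x y hxy => Subtype.ext hxy, fun x => ⟨fun hx => ?_, ?_⟩,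
    Submodule.mkQ_surjective (kerAnnihilated π X)⟩
  · exact ⟨⟨x, (Submodule.Quotient.mk_eq_zero (kerAnnihilated π X)).1 hx⟩, rfl⟩
  · rintro ⟨y, rfl⟩
    exact (Submodule.Quotient.mk_eq_zero (kerAnnihilated π X)).2 (show kerAnnihilated π X from y).2

end KerAnnihilated

/-! ### Tensor products over a noncommutative ring -/

section Tensor

open MulOpposite

variable {Γ : Type u} [Ring Γ]

namespace NCTensor

variable {X X' Y : Type u} [AddCommGroup X] [Module Γᵐᵒᵖ X] [AddCommGroup X'] [Module Γᵐᵒᵖ X']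
  [AddCommGroup Y] [Module Γ Y]

theorem addSubgroup_eq_top {S : AddSubgroup (NCTensor Γ X Y)} (h : ∀ x y, tmul x y ∈ S) :
    S = ⊤ := by
  have hS : QuotientAddGroup.mk' S = 0 :=
    hom_ext fun x y => (QuotientAddGroup.eq_zero_iff _).2 (h x y)
  exact top_unique fun z _ => (QuotientAddGroup.eq_zero_iff z).1 (DFunLike.congr_fun hS z)

variable (Γ X Y) in
/-- The universal biadditive map `(x, y) ↦ x ⊗ y`. -/
def tmulHom : X →+ Y →+ NCTensor Γ X Y :=
  AddMonoidHom.mk' (fun x => AddMonoidHom.mk' (tmul x) (tmul_add x)) fun x x' =>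
    AddMonoidHom.ext (add_tmul x x')

theorem tmul_zero (x : X) : (tmul x (0 : Y) : NCTensor Γ X Y) = 0 :=
  map_zero (tmulHom Γ X Y x)

/-- The additive map out of `X ⊗_Γ Y` induced by a balanced biadditive map. -/
def lift {A : Type*} [AddCommGroup A] (f : X →+ Y →+ A)
    (hf : ∀ (x : X) (γ : Γ) (y : Y), f (op γ • x) y = f x (γ • y)) : NCTensor Γ X Y →+ A :=
  QuotientAddGroup.lift _ (TensorProduct.liftAddHom f fun n x y => by simp) (by
    refine (AddSubgroup.closure_le _).2 ?_
    rintro _ ⟨x, γ, y, rfl⟩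
    simp [hf])

variable (X) in
/-- The coordinates of an element of `X ⊗_Γ Y` with respect to a section `s` of the canonical
surjection from a free left module to `Y`. -/
noncomputable def coordinates (s : Y →ₗ[Γ] Y →₀ Γ) : NCTensor Γ X Y →+ (Y →₀ X) :=
  lift
    (AddMonoidHom.mk'
      (fun x => (Finsupp.mapRange.addMonoidHom
        (AddMonoidHom.mk' (fun γ : Γ => op γ • x) fun γ δ => add_smul (op γ) (op δ) x)).comp
          s.toAddMonoidHom)
      fun x x' => by ext y i; exact smul_add (op (s y i)) x x')
    fun x γ y => by
      ext i
      change op (s y i) • op γ • x = op (s (γ • y) i) • x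
      rw [map_smul, Finsupp.smul_apply, smul_eq_mul, op_mul, mul_smul]

theorem coordinates_map (s : Y →ₗ[Γ] Y →₀ Γ) (f : X →ₗ[Γᵐᵒᵖ] X') (z : NCTensor Γ X Y) :
    coordinates X' s (map f .id z) = Finsupp.mapRange f (map_zero f) (coordinates X s z) := by
  have h : (coordinates X' s).comp (map f .id) =
      (Finsupp.mapRange.addMonoidHom f.toAddMonoidHom).comp (coordinates X s) :=
    hom_ext fun x y => Finsupp.ext fun i => (map_smul f (op (s y i)) x).symm
  exact DFunLike.congr_fun h z

theorem coordinates_injective {s : Y →ₗ[Γ] Y →₀ Γ}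
    (hs : Function.LeftInverse (Finsupp.linearCombination Γ id) s) :
    Function.Injective (coordinates X s) := by
  let recombine : (Y →₀ X) →+ NCTensor Γ X Y := Finsupp.liftAddHom fun y => (tmulHom Γ X Y).flip y
  have h : recombine.comp (coordinates X s) = .id _ := hom_ext fun x y =>
    calc recombine (coordinates X s (tmul x y))
        = (s y).sum fun i γ => tmul (op γ • x) i :=
          Finsupp.sum_mapRange_index (hf := by simp) fun i => map_zero ((tmulHom Γ X Y).flip i)
      _ = (s y).sum fun i γ => tmulHom Γ X Y x (γ • i) := by simp only [smul_tmul]; rfl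
      _ = tmulHom Γ X Y x (Finsupp.linearCombination Γ id (s y)) := (map_finsuppSum _ _ _).symm
      _ = tmul x y := congrArg (tmulHom Γ X Y x) (hs y)
  exact Function.LeftInverse.injective (g := recombine) (DFunLike.congr_fun h)

theorem map_injective [Module.Projective Γ Y] {f : X →ₗ[Γᵐᵒᵖ] X'} (hf : Function.Injective f) :
    Function.Injective (map f (.id : Y →ₗ[Γ] Y)) := by
  obtain ⟨s, hs⟩ := Module.Projective.out (R := Γ) (P := Y)
  have h : Function.Injective (coordinates X' s ∘ map f .id) := by
    simpa only [Function.comp_def, coordinates_map] using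
      (Finsupp.mapRange_injective f (map_zero f) hf).comp (coordinates_injective hs)
  exact h.of_comp

variable {M : Type u} [AddCommGroup M] [Module Γ M] [Module Γᵐᵒᵖ M] [SMulCommClass Γ Γᵐᵒᵖ M]

attribute [local instance] rightModule

theorem smul_tmul_right (γ : Γᵐᵒᵖ) (x : X) (m : M) :
    γ • (tmul x m : NCTensor Γ X M) = tmul x (γ • m) := rfl

variable (M) in
/-- The map of right modules `f ⊗ M : X ⊗_Γ M → X' ⊗_Γ M`. -/
noncomputable def mapLeft (f : X →ₗ[Γᵐᵒᵖ] X') : NCTensor Γ X M →ₗ[Γᵐᵒᵖ] NCTensor Γ X' M where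
  toFun := map f .id
  map_add' := map_add _
  map_smul' γ z := by
    have h : (map f .id).comp (rightAction γ : AddMonoid.End (NCTensor Γ X M)) =
        (rightAction γ : AddMonoid.End (NCTensor Γ X' M)).comp (map f .id) :=
      hom_ext fun x y => rfl
    exact DFunLike.congr_fun h z

theorem mapLeft_tmul (f : X →ₗ[Γᵐᵒᵖ] X') (x : X) (m : M) :
    mapLeft M f (tmul x m) = tmul (f x) m := rfl

end NCTensor

end Tensor

/-! ### Induction to the trivial extension -/

section Induction

open MulOpposite

attribute [local instance] NCTensor.rightModule

variable {Γ : Type u} [Ring Γ] {M : Type u} [AddCommGroup M] [Module Γ M]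

/-- The right module `Y ⊗_Γ (Γ ⋉ M) = Y ⊕ (Y ⊗_Γ M)` over the trivial extension `Γ ⋉ M`. -/
def Induced (Γ : Type u) [Ring Γ] (M : Type u) [AddCommGroup M] [Module Γ M] (Y : Type u)
    [AddCommGroup Y] [Module Γᵐᵒᵖ Y] : Type u :=
  Y × NCTensor Γ Y M

namespace Induced

variable {Y : Type u} [AddCommGroup Y] [Module Γᵐᵒᵖ Y]

instance : AddCommGroup (Induced Γ M Y) := inferInstanceAs (AddCommGroup (Y × NCTensor Γ Y M))

@[ext]
theorem ext {p q : Induced Γ M Y} (h₁ : p.1 = q.1) (h₂ : p.2 = q.2) : p = q :=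
  Prod.ext h₁ h₂

theorem fst_add (p q : Induced Γ M Y) : (p + q).1 = p.1 + q.1 := rfl

theorem snd_add (p q : Induced Γ M Y) : (p + q).2 = p.2 + q.2 := rfl

variable (Γ M) in
/-- The inclusion `y ↦ y ⊗ 1` of `Y` in the module induced from it. -/
def of : Y →+ Induced Γ M Y := AddMonoidHom.inl Y (NCTensor Γ Y M)

end Induced

variable [Module Γᵐᵒᵖ M]

variable (Γ M) in
/-- The inclusion of `Γ` in its trivial extension, on the opposite rings. -/
def inlOp : Γᵐᵒᵖ →+* (TrivSqZeroExt Γ M)ᵐᵒᵖ :=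
  RingHom.op (TrivSqZeroExt.inlHom Γ M)

variable (Γ M) in
/-- The projection of the trivial extension to `Γ`, on the opposite rings. -/
def fstOp : (TrivSqZeroExt Γ M)ᵐᵒᵖ →+* Γᵐᵒᵖ :=
  RingHom.op
    { toFun := TrivSqZeroExt.fst
      map_one' := rfl
      map_mul' := fun _ _ => rfl
      map_zero' := rfl
      map_add' := fun _ _ => rfl }

theorem fstOp_comp_inlOp : (fstOp Γ M).comp (inlOp Γ M) = RingHom.id Γᵐᵒᵖ := rfl

theorem fstOp_surjective : Function.Surjective (fstOp Γ M) := fun γ => ⟨inlOp Γ M γ, rfl⟩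

theorem mul_eq_zero_of_fstOp (a b : (TrivSqZeroExt Γ M)ᵐᵒᵖ) (ha : fstOp Γ M a = 0)
    (hb : fstOp Γ M b = 0) : a * b = 0 := by
  have ha' : a.unop.fst = 0 := op_injective ha
  have hb' : b.unop.fst = 0 := op_injective hb
  exact unop_injective (TrivSqZeroExt.ext (by simp [ha']) (by simp [ha', hb']))

variable [SMulCommClass Γ Γᵐᵒᵖ M]

instance : Module.Finite (TrivSqZeroExt Γ M)ᵐᵒᵖ (restrict (fstOp Γ M) Γᵐᵒᵖ) :=
  finite_restrict_of_surjective fstOp_surjective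

variable (Γ M) in
/-- As a right `Γ`-module, the trivial extension is `Γ ⊕ M`. -/
def prodEquivRestrict : (Γᵐᵒᵖ × M) ≃ₗ[Γᵐᵒᵖ] restrict (inlOp Γ M) (TrivSqZeroExt Γ M)ᵐᵒᵖ where
  toFun p := op (TrivSqZeroExt.inl p.1.unop + TrivSqZeroExt.inr p.2)
  invFun a := (op (unop (show (TrivSqZeroExt Γ M)ᵐᵒᵖ from a)).fst,
    (unop (show (TrivSqZeroExt Γ M)ᵐᵒᵖ from a)).snd)
  left_inv p := by simp
  right_inv a := unop_injective (TrivSqZeroExt.inl_fst_add_inr_snd_eq _)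
  map_add' p q := unop_injective (TrivSqZeroExt.ext
    (show _ = p.1.unop + 0 + (q.1.unop + 0) by simp) (show _ = 0 + p.2 + (0 + q.2) by simp))
  map_smul' c p := unop_injective (TrivSqZeroExt.ext
    (show _ = (p.1.unop + 0) * c.unop by simp)
    (show _ = (p.1.unop + 0) • 0 + c • (0 + p.2) by simp))

instance [Module.Finite Γᵐᵒᵖ M] :
    Module.Finite Γᵐᵒᵖ (restrict (inlOp Γ M) (TrivSqZeroExt Γ M)ᵐᵒᵖ) :=
  Module.Finite.equiv (prodEquivRestrict Γ M)

instance [Module.Projective Γᵐᵒᵖ M] :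
    Module.Projective Γᵐᵒᵖ (restrict (inlOp Γ M) (TrivSqZeroExt Γ M)ᵐᵒᵖ) :=
  Module.Projective.of_equiv (prodEquivRestrict Γ M)

namespace Induced

variable {Y Y' Y'' : Type u} [AddCommGroup Y] [Module Γᵐᵒᵖ Y] [AddCommGroup Y'] [Module Γᵐᵒᵖ Y']
  [AddCommGroup Y''] [Module Γᵐᵒᵖ Y'']

noncomputable instance : SMul (TrivSqZeroExt Γ M)ᵐᵒᵖ (Induced Γ M Y) where
  smul a p := (op a.unop.fst • p.1, op a.unop.fst • p.2 + NCTensor.tmul p.1 a.unop.snd)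

theorem fst_smul (a : (TrivSqZeroExt Γ M)ᵐᵒᵖ) (p : Induced Γ M Y) :
    (a • p).1 = op a.unop.fst • p.1 := rfl

theorem snd_smul (a : (TrivSqZeroExt Γ M)ᵐᵒᵖ) (p : Induced Γ M Y) :
    (a • p).2 = op a.unop.fst • p.2 + NCTensor.tmul p.1 a.unop.snd := rfl

noncomputable instance : Module (TrivSqZeroExt Γ M)ᵐᵒᵖ (Induced Γ M Y) :=
  Module.ofMinimalAxioms
    (fun a p q => Induced.ext (smul_add _ _ _) (by
      simp only [snd_smul, snd_add, fst_add, smul_add, NCTensor.add_tmul, add_add_add_comm]))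
    (fun a b p => Induced.ext (add_smul (op a.unop.fst) (op b.unop.fst) p.1) (by
      simp only [snd_smul, snd_add, MulOpposite.unop_add, TrivSqZeroExt.fst_add,
        TrivSqZeroExt.snd_add, MulOpposite.op_add, add_smul, NCTensor.tmul_add, add_add_add_comm]))
    (fun a b p => Induced.ext (mul_smul (op a.unop.fst) (op b.unop.fst) p.1) (by
      simp only [snd_smul, fst_smul, MulOpposite.unop_mul, TrivSqZeroExt.fst_mul,
        TrivSqZeroExt.snd_mul, MulOpposite.op_mul, mul_smul, smul_add, NCTensor.tmul_add,
        NCTensor.smul_tmul, NCTensor.smul_tmul_right]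
      abel))
    fun p => Induced.ext (one_smul _ p.1) (by
      simp only [snd_smul, unop_one, TrivSqZeroExt.fst_one, TrivSqZeroExt.snd_one, op_one, one_smul,
        NCTensor.tmul_zero, add_zero])

theorem of_smul (c : Γᵐᵒᵖ) (y : Y) : of Γ M (c • y) = inlOp Γ M c • of Γ M y :=
  Induced.ext rfl <|
    calc (0 : NCTensor Γ Y M) = c • (0 : NCTensor Γ Y M) + NCTensor.tmul y (0 : M) := by
          rw [smul_zero, NCTensor.tmul_zero, add_zero]

theorem inr_smul_of (y : Y) (m : M) :
    op (TrivSqZeroExt.inr m : TrivSqZeroExt Γ M) • of Γ M y =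
      ((0, NCTensor.tmul y m) : Y × NCTensor Γ Y M) :=
  Induced.ext (zero_smul Γᵐᵒᵖ y) <|
    calc (0 : Γᵐᵒᵖ) • (0 : NCTensor Γ Y M) + NCTensor.tmul y m = NCTensor.tmul y m := by
          rw [zero_smul, zero_add]

theorem hom_ext {X : Type u} [AddCommGroup X] [Module (TrivSqZeroExt Γ M)ᵐᵒᵖ X]
    {f g : Induced Γ M Y →ₗ[(TrivSqZeroExt Γ M)ᵐᵒᵖ] X} (h : ∀ y, f (of Γ M y) = g (of Γ M y)) :
    f = g := by
  let i : NCTensor Γ Y M →+ Induced Γ M Y := AddMonoidHom.inr Y (NCTensor Γ Y M)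
  have h' : f.toAddMonoidHom.comp i = g.toAddMonoidHom.comp i := NCTensor.hom_ext fun y m =>
    calc f (i (NCTensor.tmul y m)) = f (op (TrivSqZeroExt.inr m) • of Γ M y) :=
          congrArg f (inr_smul_of y m).symm
      _ = g (op (TrivSqZeroExt.inr m) • of Γ M y) := by
          rw [map_smul, map_smul, h]
      _ = g (i (NCTensor.tmul y m)) := congrArg g (inr_smul_of y m)
  ext p
  have hp : p = of Γ M p.1 + i p.2 := Induced.ext (add_zero p.1).symm (zero_add p.2).symm
  rw [hp, map_add, map_add, h]
  exact congrArg _ (DFunLike.congr_fun h' p.2)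

variable (Γ M Y) in
/-- The `Γ`-linear map `y ↦ y ⊗ 1`: the unit of the adjunction between induction and
restriction. -/
noncomputable def unit : Y →ₗ[Γᵐᵒᵖ] restrict (inlOp Γ M) (Induced Γ M Y) where
  toFun := of Γ M
  map_add' := map_add (of Γ M)
  map_smul' := of_smul

theorem span_image_of {s : Set Y} (hs : Submodule.span Γᵐᵒᵖ s = ⊤) :
    Submodule.span (TrivSqZeroExt Γ M)ᵐᵒᵖ (of Γ M '' s) = ⊤ := by
  set N := Submodule.span (TrivSqZeroExt Γ M)ᵐᵒᵖ (of Γ M '' s)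
  have hs' : ((ModuleCat.restrictScalars (inlOp Γ M)).map (ModuleCat.ofHom N.mkQ)).hom ∘ₗ
      unit Γ M Y = 0 :=
    LinearMap.ext_on hs fun y hy =>
      (Submodule.Quotient.mk_eq_zero N).2 (Submodule.subset_span ⟨y, hy, rfl⟩)
  have hN : N.mkQ = 0 := hom_ext fun y => LinearMap.congr_fun hs' y
  exact top_unique fun p _ => (Submodule.Quotient.mk_eq_zero N).1 (LinearMap.congr_fun hN p)

instance [Module.Finite Γᵐᵒᵖ Y] : Module.Finite (TrivSqZeroExt Γ M)ᵐᵒᵖ (Induced Γ M Y) := by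
  classical
  obtain ⟨s, hs⟩ := Module.Finite.fg_top (R := Γᵐᵒᵖ) (M := Y)
  exact ⟨s.image (of Γ M), by rw [Finset.coe_image]; exact span_image_of hs⟩

variable (M) in
/-- The map of induced modules obtained from a map of right `Γ`-modules. -/
noncomputable def map (f : Y →ₗ[Γᵐᵒᵖ] Y') :
    Induced Γ M Y →ₗ[(TrivSqZeroExt Γ M)ᵐᵒᵖ] Induced Γ M Y' where
  toFun p := (f p.1, NCTensor.mapLeft M f p.2)
  map_add' p q := Induced.ext (map_add f _ _) (map_add (NCTensor.mapLeft M f) _ _)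
  map_smul' a p := Induced.ext (map_smul f _ _) <|
    calc NCTensor.mapLeft M f (op a.unop.fst • p.2 + NCTensor.tmul p.1 a.unop.snd)
        = op a.unop.fst • NCTensor.mapLeft M f p.2 + NCTensor.tmul (f p.1) a.unop.snd := by
          rw [map_add, map_smul, NCTensor.mapLeft_tmul]

theorem map_of (f : Y →ₗ[Γᵐᵒᵖ] Y') (y : Y) : map M f (of Γ M y) = of Γ M (f y) :=
  Induced.ext rfl (map_zero (NCTensor.mapLeft M f))

theorem map_id : map M (.id : Y →ₗ[Γᵐᵒᵖ] Y) = .id := hom_ext (map_of _)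

theorem map_comp (g : Y' →ₗ[Γᵐᵒᵖ] Y'') (f : Y →ₗ[Γᵐᵒᵖ] Y') :
    map M (g ∘ₗ f) = map M g ∘ₗ map M f :=
  hom_ext fun y => by
    rw [map_of, LinearMap.comp_apply, LinearMap.comp_apply, map_of, map_of]

theorem map_injective [Module.Projective Γ M] {f : Y →ₗ[Γᵐᵒᵖ] Y'} (hf : Function.Injective f) :
    Function.Injective (map M f) :=
  hf.prodMap (NCTensor.map_injective hf)

end Induced

section Counit

variable (X : Type u) [AddCommGroup X] [Module (TrivSqZeroExt Γ M)ᵐᵒᵖ X]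

/-- The multiplication `X ⊗_Γ M → X` on a right module `X` over the trivial extension. -/
noncomputable def mulM : NCTensor Γ (restrict (inlOp Γ M) X) M →+ X :=
  NCTensor.lift
    (AddMonoidHom.mk'
      (fun x => AddMonoidHom.mk'
        (fun m => op (TrivSqZeroExt.inr m : TrivSqZeroExt Γ M) • (show X from x)) fun m m' => by
          rw [TrivSqZeroExt.inr_add, MulOpposite.op_add]
          exact add_smul _ _ (show X from x))
      fun x y => AddMonoidHom.ext fun m => smul_add _ (show X from x) (show X from y))
    fun x γ m => by
      change op (TrivSqZeroExt.inr m : TrivSqZeroExt Γ M) •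
        op (TrivSqZeroExt.inl γ : TrivSqZeroExt Γ M) • (show X from x) =
          op (TrivSqZeroExt.inr (γ • m) : TrivSqZeroExt Γ M) • (show X from x)
      rw [← mul_smul, ← MulOpposite.op_mul, TrivSqZeroExt.inl_mul_inr]

variable {X}

theorem mulM_tmul (x : restrict (inlOp Γ M) X) (m : M) : mulM X (NCTensor.tmul x m) =
    op (TrivSqZeroExt.inr m : TrivSqZeroExt Γ M) • (show X from x) := rfl

theorem smul_mulM (a : (TrivSqZeroExt Γ M)ᵐᵒᵖ) (z : NCTensor Γ (restrict (inlOp Γ M) X) M) :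
    a • mulM X z = mulM X (op a.unop.fst • z) := by
  have h : (DistribSMul.toAddMonoidHom X a).comp (mulM X) =
      (mulM X).comp (DistribSMul.toAddMonoidHom _ (op a.unop.fst)) := NCTensor.hom_ext fun x m => by
    change a • op (TrivSqZeroExt.inr m : TrivSqZeroExt Γ M) • (show X from x) =
      op (TrivSqZeroExt.inr (op a.unop.fst • m) : TrivSqZeroExt Γ M) • (show X from x)
    rw [← mul_smul]
    congr 1
    exact unop_injective (TrivSqZeroExt.ext (by simp) (by simp))
  exact DFunLike.congr_fun h z

theorem op_inl_smul_add_op_inr_smul (a : (TrivSqZeroExt Γ M)ᵐᵒᵖ) (x : X) :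
    op (TrivSqZeroExt.inl a.unop.fst : TrivSqZeroExt Γ M) • x +
      op (TrivSqZeroExt.inr a.unop.snd : TrivSqZeroExt Γ M) • x = a • x := by
  rw [← add_smul, ← MulOpposite.op_add, TrivSqZeroExt.inl_fst_add_inr_snd_eq, op_unop]

variable (X)

/-- The multiplication `X ⊗_Γ (Γ ⋉ M) → X` on a right module `X` over the trivial extension. -/
noncomputable def counit :
    Induced Γ M (restrict (inlOp Γ M) X) →ₗ[(TrivSqZeroExt Γ M)ᵐᵒᵖ] X where
  toFun p := (show X from p.1) + mulM X p.2
  map_add' p q := by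
    rw [Induced.snd_add, map_add]
    exact add_add_add_comm _ _ _ _
  map_smul' a p := by
    change op (TrivSqZeroExt.inl a.unop.fst : TrivSqZeroExt Γ M) • (show X from p.1) +
      mulM X (op a.unop.fst • p.2 + NCTensor.tmul p.1 a.unop.snd) =
        a • ((show X from p.1) + mulM X p.2)
    rw [map_add, mulM_tmul, smul_add, smul_mulM, ← op_inl_smul_add_op_inr_smul a (show X from p.1)]
    abel

variable {X}

theorem counit_of (x : restrict (inlOp Γ M) X) : counit X (Induced.of Γ M x) = x :=
  (congrArg (_ + ·) (map_zero (mulM X))).trans (add_zero _)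

theorem counit_comp_map_unit {Y : Type u} [AddCommGroup Y] [Module Γᵐᵒᵖ Y] :
    counit (Induced Γ M Y) ∘ₗ Induced.map M (Induced.unit Γ M Y) = .id :=
  Induced.hom_ext fun y =>
    (congrArg (counit _) (Induced.map_of (Induced.unit Γ M Y) y)).trans (counit_of _)

end Counit

variable (Γ M) in
/-- Induction of finitely generated right modules to the trivial extension. -/
noncomputable def inducedFG :
    FGModuleCat.{u} Γᵐᵒᵖ ⥤ FGModuleCat.{u} (TrivSqZeroExt Γ M)ᵐᵒᵖ where
  obj Y := FGModuleCat.of _ (Induced Γ M Y)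
  map f := FGModuleCat.ofHom (Induced.map M f.hom.hom)
  map_id _ := FGModuleCat.hom_ext Induced.map_id
  map_comp f g := FGModuleCat.hom_ext (Induced.map_comp g.hom.hom f.hom.hom)

variable [Module.Finite Γᵐᵒᵖ M]

variable (Γ M) in
/-- Induction along `Γ → Γ ⋉ M` is left adjoint to restriction. -/
noncomputable def inducedAdjunction : inducedFG Γ M ⊣ restrictFG (inlOp Γ M) where
  unit :=
    { app := fun Y => FGModuleCat.ofHom (Induced.unit Γ M Y)
      naturality := fun _ _ f => FGModuleCat.hom_ext (LinearMap.ext fun y =>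
        (Induced.map_of f.hom.hom y).symm) }
  counit :=
    { app := fun X => FGModuleCat.ofHom (counit X)
      naturality := fun X X' f => FGModuleCat.hom_ext (Induced.hom_ext fun x => by
        refine Eq.trans (congrArg (counit X') (Induced.map_of _ x)) ?_
        exact (counit_of _).trans (congrArg f.hom.hom (counit_of x)).symm) }
  left_triangle_components _ := FGModuleCat.hom_ext counit_comp_map_unit
  right_triangle_components X := FGModuleCat.hom_ext (LinearMap.ext fun x => counit_of x)

section Exact

variable [IsNoetherianRing Γᵐᵒᵖ] [IsNoetherianRing (TrivSqZeroExt Γ M)ᵐᵒᵖ]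

instance : (inducedFG Γ M).Additive := (inducedAdjunction Γ M).left_adjoint_additive

instance : (inducedFG Γ M).PreservesProjectiveObjects :=
  Functor.preservesProjectiveObjects_of_adjunction_of_preservesEpimorphisms
    (inducedAdjunction Γ M)

instance : PreservesFiniteColimits (inducedFG Γ M) :=
  have := (inducedAdjunction Γ M).leftAdjoint_preservesColimits
  inferInstance

instance [Module.Projective Γ M] : (inducedFG Γ M).PreservesMonomorphisms where
  preserves f _ := mono_of_injective _ (Induced.map_injective (injective_of_mono f))

instance [Module.Projective Γ M] : PreservesFiniteLimits (inducedFG Γ M) :=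
  have h : PreservesFiniteLimits (inducedFG Γ M) ∧ PreservesFiniteColimits (inducedFG Γ M) :=
    ((Functor.exact_tfae (inducedFG Γ M)).out 2 3).1
      (inducedFG Γ M).preservesHomology_of_preservesMonos_and_cokernels
  h.1

end Exact

end Induction

/-! ### The kernel of the counit and tensor nilpotence -/

section Nilpotence

open MulOpposite

attribute [local instance] NCTensor.rightModule

variable {Γ : Type u} [Ring Γ]

/-- A right module `Z` is generated by a right module `N` if it is the sum of the images of the
homomorphisms from `N` to `Z`. -/
def IsGeneratedBy (N Z : Type u) [AddCommGroup N] [Module Γᵐᵒᵖ N] [AddCommGroup Z]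
    [Module Γᵐᵒᵖ Z] : Prop :=
  ⨆ θ : N →ₗ[Γᵐᵒᵖ] Z, LinearMap.range θ = ⊤

variable {N Z Z' : Type u} [AddCommGroup N] [Module Γᵐᵒᵖ N] [AddCommGroup Z] [Module Γᵐᵒᵖ Z]
  [AddCommGroup Z'] [Module Γᵐᵒᵖ Z']

theorem IsGeneratedBy.of_surjective (h : IsGeneratedBy (Γ := Γ) N Z) (κ : Z →ₗ[Γᵐᵒᵖ] Z')
    (hκ : Function.Surjective κ) : IsGeneratedBy (Γ := Γ) N Z' := by
  refine top_unique ?_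
  rw [← LinearMap.range_eq_top.2 hκ, ← Submodule.map_top, ← h, Submodule.map_iSup]
  exact iSup_le fun θ => (LinearMap.range_comp θ κ).symm.trans_le (le_iSup LinearMap.range (κ ∘ₗ θ))

theorem IsGeneratedBy.subsingleton [Subsingleton N] (h : IsGeneratedBy (Γ := Γ) N Z) :
    Subsingleton Z := by
  have hθ (θ : N →ₗ[Γᵐᵒᵖ] Z) : LinearMap.range θ = ⊥ := by
    rw [Subsingleton.elim θ 0, LinearMap.range_zero]
  exact (Submodule.subsingleton_iff Γᵐᵒᵖ).1
    (subsingleton_of_bot_eq_top (by simpa only [IsGeneratedBy, hθ, iSup_const] using h))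

variable {M : Type u} [AddCommGroup M] [Module Γ M] [Module Γᵐᵒᵖ M] [SMulCommClass Γ Γᵐᵒᵖ M]

theorem IsGeneratedBy.tensor (h : IsGeneratedBy (Γ := Γ) N Z) :
    IsGeneratedBy (Γ := Γ) (NCTensor Γ N M) (NCTensor Γ Z M) := by
  set W := ⨆ θ : NCTensor Γ N M →ₗ[Γᵐᵒᵖ] NCTensor Γ Z M, LinearMap.range θ
  have hW (z : Z) (m : M) : NCTensor.tmul z m ∈ W := by
    have hz : z ∈ ⨆ θ : N →ₗ[Γᵐᵒᵖ] Z, LinearMap.range θ := h ▸ Submodule.mem_top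
    induction hz using Submodule.iSup_induction' with
    | mem θ z hz =>
      obtain ⟨x, rfl⟩ := hz
      exact Submodule.mem_iSup_of_mem (NCTensor.mapLeft M θ) ⟨NCTensor.tmul x m, rfl⟩
    | zero =>
      have h0 : (NCTensor.tmul 0 m : NCTensor Γ Z M) = 0 :=
        map_zero ((NCTensor.tmulHom Γ Z M).flip m)
      exact h0 ▸ W.zero_mem
    | add z z' _ _ hz hz' => exact NCTensor.add_tmul (Γ := Γ) z z' m ▸ W.add_mem hz hz'
  exact Submodule.toAddSubgroup_injective (NCTensor.addSubgroup_eq_top hW)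

theorem isGeneratedBy_tensor : IsGeneratedBy (Γ := Γ) M (NCTensor Γ Z M) := by
  let tmulLeft (z : Z) : M →ₗ[Γᵐᵒᵖ] NCTensor Γ Z M :=
    { toFun := NCTensor.tmul z, map_add' := NCTensor.tmul_add z, map_smul' := fun _ _ => rfl }
  exact Submodule.toAddSubgroup_injective <| NCTensor.addSubgroup_eq_top fun z m =>
    Submodule.mem_iSup_of_mem (tmulLeft z) ⟨m, rfl⟩

section KerCounit

variable {X : Type u} [AddCommGroup X] [Module (TrivSqZeroExt Γ M)ᵐᵒᵖ X]

theorem counit_surjective : Function.Surjective (counit (Γ := Γ) (M := M) X) := fun x =>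
  ⟨Induced.of Γ M x, counit_of x⟩

variable (Γ M X) in
/-- The parametrization `z ↦ (-z, z)` of the kernel of the multiplication
`X ⊕ (X ⊗_Γ M) → X`. -/
noncomputable def toKerCounit : NCTensor Γ (restrict (inlOp Γ M) X) M →ₗ[Γᵐᵒᵖ]
    restrict (inlOp Γ M) (LinearMap.ker (counit (Γ := Γ) (M := M) X)) where
  toFun z := (⟨((-mulM X z, z) : X × NCTensor Γ (restrict (inlOp Γ M) X) M),
    neg_add_cancel (mulM X z)⟩ : LinearMap.ker (counit X))
  map_add' z z' := Subtype.ext <| Induced.ext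
    ((congrArg Neg.neg (map_add (mulM X) z z')).trans (neg_add _ _)) rfl
  map_smul' c z := Subtype.ext <| Induced.ext
    ((congrArg Neg.neg (smul_mulM (inlOp Γ M c) z).symm).trans
      (smul_neg (inlOp Γ M c) (mulM X z)).symm)
    (by rw [NCTensor.tmul_zero, add_zero] :
      c • z = c • z + NCTensor.tmul (show restrict (inlOp Γ M) X from -mulM X z) (0 : M))

theorem toKerCounit_surjective : Function.Surjective (toKerCounit Γ M X) := fun p => by
  obtain ⟨p, hp⟩ : LinearMap.ker (counit X) := p
  exact ⟨p.2, Subtype.ext (Induced.ext (eq_neg_of_add_eq_zero_left hp).symm rfl)⟩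

end KerCounit

variable [Module.Finite Γᵐᵒᵖ M] [IsNoetherianRing (TrivSqZeroExt Γ M)ᵐᵒᵖ]

variable (Γ M) in
/-- The kernel of the counit, as a finitely generated module. -/
noncomputable def kerCounit (X : FGModuleCat.{u} (TrivSqZeroExt Γ M)ᵐᵒᵖ) :
    FGModuleCat.{u} (TrivSqZeroExt Γ M)ᵐᵒᵖ :=
  FGModuleCat.of _ (LinearMap.ker (counit (Γ := Γ) (M := M) X))

theorem isExtension_kerCounit (X : FGModuleCat.{u} (TrivSqZeroExt Γ M)ᵐᵒᵖ) :
    IsExtension (kerCounit Γ M X) ((inducedFG Γ M).obj ((restrictFG (inlOp Γ M)).obj X)) X :=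
  ⟨FGModuleCat.ofHom (LinearMap.ker (counit X)).subtype, FGModuleCat.ofHom (counit X),
    FGModuleCat.hom_ext (LinearMap.ext fun x => x.2),
    (shortExact_fgModuleCat_iff _).2
      ⟨Subtype.val_injective, LinearMap.exact_subtype_ker_map _, counit_surjective⟩⟩

theorem isGeneratedBy_iterate_kerCounit (X : FGModuleCat.{u} (TrivSqZeroExt Γ M)ᵐᵒᵖ) (j : ℕ) :
    IsGeneratedBy (Γ := Γ) (tensorPower Γ M (j + 1)).carrier
      (restrict (inlOp Γ M) ((kerCounit Γ M)^[j + 1] X)) := by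
  induction j with
  | zero =>
    have h : IsGeneratedBy (Γ := Γ) M (NCTensor Γ (restrict (inlOp Γ M) X) M) :=
      isGeneratedBy_tensor
    exact h.of_surjective _ toKerCounit_surjective
  | succ j ih =>
    rw [Function.iterate_succ_apply']
    exact ih.tensor.of_surjective _ toKerCounit_surjective

theorem isZero_iterate_kerCounit {n : ℕ} (hn : n ≠ 0)
    (h : Subsingleton (tensorPower Γ M n).carrier) (X : FGModuleCat.{u} (TrivSqZeroExt Γ M)ᵐᵒᵖ) :
    IsZero ((kerCounit Γ M)^[n] X) := by
  obtain ⟨j, rfl⟩ := Nat.exists_eq_add_one_of_ne_zero hn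
  have : Subsingleton ((kerCounit Γ M)^[j + 1] X) :=
    (isGeneratedBy_iterate_kerCounit X j).subsingleton
  exact (IsZero.iff_id_eq_zero _).2 <| FGModuleCat.hom_ext <| LinearMap.ext fun x =>
    Subsingleton.elim (α := (kerCounit Γ M)^[j + 1] X) _ _

end Nilpotence

/-! ### Dimensions of trivial extensions -/

section TrivSqZeroExt

variable {Γ M : Type u} [Ring Γ] [AddCommGroup M] [Module Γ M] [Module Γᵐᵒᵖ M]

theorem inlOp_comp_fstOp [Subsingleton M] :
    (inlOp Γ M).comp (fstOp Γ M) = RingHom.id (TrivSqZeroExt Γ M)ᵐᵒᵖ :=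
  RingHom.ext fun _ =>
    MulOpposite.unop_injective (TrivSqZeroExt.ext rfl (Subsingleton.elim (α := M) _ _))

variable [SMulCommClass Γ Γᵐᵒᵖ M]

theorem le_min_two_mul_add_one_sub_one {n : ℕ} (hn : 1 ≤ n)
    (hM : Subsingleton (tensorPower Γ M n).carrier) {x y : ℕ∞} (h₁ : [Subsingleton M] → x ≤ y)
    (h₂ : x + 1 ≤ (2 : ℕ) * (y + 1)) : x ≤ (min n 2 : ℕ) * (y + 1) - 1 := by
  refine ENat.le_sub_of_add_le_right ENat.one_ne_top ?_
  obtain rfl | hn := hn.eq_or_lt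
  · have : Subsingleton M := hM
    rw [min_eq_left one_le_two, Nat.cast_one, one_mul]
    gcongr
    exact h₁
  · rwa [min_eq_right (Nat.succ_le_of_lt hn)]

variable [Module.Finite Γᵐᵒᵖ M] [IsNoetherianRing Γᵐᵒᵖ]

variable (Γ M) in
theorem isNoetherianRing_trivSqZeroExt_op : IsNoetherianRing (TrivSqZeroExt Γ M)ᵐᵒᵖ :=
  isNoetherianRing_of_finite_restrict (inlOp Γ M)

variable [IsNoetherianRing (TrivSqZeroExt Γ M)ᵐᵒᵖ]

theorem IT_le_IT_trivSqZeroExt [Module.Projective Γᵐᵒᵖ M] : IT Γ ≤ IT (TrivSqZeroExt Γ M) :=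
  have := preservesProjectiveObjects_restrictFG (inlOp Γ M)
  igusaTodorovDistance_le_of_section (restrictFG (inlOp Γ M)) (restrictFG (fstOp Γ M))
    (restrictFGCompIso _ _ fstOp_comp_inlOp)

theorem IT_trivSqZeroExt_add_one_le [Module.Projective Γ M] {n : ℕ} (hn : n ≠ 0)
    (hM : Subsingleton (tensorPower Γ M n).carrier) :
    IT (TrivSqZeroExt Γ M) + 1 ≤ n * (IT Γ + 1) :=
  igusaTodorovDistance_add_one_le_of_nilpotent (inducedFG Γ M) (isProjectiveGenerator_self _)
    (isProjectiveGenerator_self _) (restrictFG (inlOp Γ M)).obj (kerCounit Γ M)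
    isExtension_kerCounit hn (isZero_iterate_kerCounit hn hM)

theorem extDim_le_extDim_trivSqZeroExt : extDim Γ ≤ extDim (TrivSqZeroExt Γ M) :=
  extensionDimension_le_of_section (restrictFG (inlOp Γ M)) (restrictFG (fstOp Γ M))
    (restrictFGCompIso _ _ fstOp_comp_inlOp)

theorem extDim_trivSqZeroExt_le [Subsingleton M] : extDim (TrivSqZeroExt Γ M) ≤ extDim Γ :=
  extensionDimension_le_of_section (restrictFG (fstOp Γ M)) (restrictFG (inlOp Γ M))
    (restrictFGCompIso _ _ inlOp_comp_fstOp)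

theorem extDim_trivSqZeroExt_add_one_le :
    extDim (TrivSqZeroExt Γ M) + 1 ≤ (2 : ℕ) * (extDim Γ + 1) :=
  extensionDimension_add_one_le_of_extension (restrictFG (fstOp Γ M))
    (kerAnnihilatedFunctor (fstOp Γ M) ⋙ restrictFG (inlOp Γ M)).obj
    (quotientKerAnnihilatedFunctor (fstOp Γ M) ⋙ restrictFG (inlOp Γ M)).obj fun X =>
      .of_shortExact (shortExact_kerAnnihilated _ _ fstOp_comp_inlOp mul_eq_zero_of_fstOp X)

theorem derDim_le_derDim_trivSqZeroExt : derDim Γ ≤ derDim (TrivSqZeroExt Γ M) :=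
  derivedDimension_le_of_section (restrictFG (inlOp Γ M)) (restrictFG (fstOp Γ M))
    (restrictFGCompIso _ _ fstOp_comp_inlOp)

theorem derDim_trivSqZeroExt_le [Subsingleton M] : derDim (TrivSqZeroExt Γ M) ≤ derDim Γ :=
  derivedDimension_le_of_section (restrictFG (fstOp Γ M)) (restrictFG (inlOp Γ M))
    (restrictFGCompIso _ _ inlOp_comp_fstOp)

theorem derDim_trivSqZeroExt_add_one_le :
    derDim (TrivSqZeroExt Γ M) + 1 ≤ (2 : ℕ) * (derDim Γ + 1) :=
  derivedDimension_add_one_le_of_extension (restrictFG (fstOp Γ M))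
    (kerAnnihilatedFunctor (fstOp Γ M) ⋙ restrictFG (inlOp Γ M))
    (quotientKerAnnihilatedFunctor (fstOp Γ M) ⋙ restrictFG (inlOp Γ M))
    (kerAnnihilatedInclusion _ _ fstOp_comp_inlOp)
    (kerAnnihilatedProjection _ _ fstOp_comp_inlOp mul_eq_zero_of_fstOp)
    (kerAnnihilatedInclusion_comp_projection _ _ fstOp_comp_inlOp mul_eq_zero_of_fstOp)
    (shortExact_kerAnnihilated _ _ fstOp_comp_inlOp mul_eq_zero_of_fstOp)

end TrivSqZeroExt

end CleftDim

theorem mainTheorem8_general {Γ M : Type u} [Ring Γ] [IsNoetherianRing Γᵐᵒᵖ] [AddCommGroup M]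
    [Module Γ M] [Module Γᵐᵒᵖ M] [SMulCommClass Γ Γᵐᵒᵖ M] [Module.Finite Γᵐᵒᵖ M] (n : ℕ)
    (hn : 1 ≤ n) (hM : Subsingleton (CleftDim.tensorPower Γ M n).carrier) :
    haveI : IsNoetherianRing (TrivSqZeroExt Γ M)ᵐᵒᵖ :=
      CleftDim.isNoetherianRing_trivSqZeroExt_op Γ M
    ((Module.Projective Γᵐᵒᵖ M → CleftDim.IT Γ ≤ CleftDim.IT (TrivSqZeroExt Γ M)) ∧
      (Module.Projective Γ M →
        CleftDim.IT (TrivSqZeroExt Γ M) ≤ n * (CleftDim.IT Γ + 1) - 1)) ∧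
    (CleftDim.extDim Γ ≤ CleftDim.extDim (TrivSqZeroExt Γ M) ∧
      CleftDim.extDim (TrivSqZeroExt Γ M) ≤ (min n 2 : ℕ) * (CleftDim.extDim Γ + 1) - 1) ∧
    (CleftDim.derDim Γ ≤ CleftDim.derDim (TrivSqZeroExt Γ M) ∧
      CleftDim.derDim (TrivSqZeroExt Γ M) ≤ (min n 2 : ℕ) * (CleftDim.derDim Γ + 1) - 1) := by
  have := CleftDim.isNoetherianRing_trivSqZeroExt_op Γ M
  refine ⟨⟨fun _ => CleftDim.IT_le_IT_trivSqZeroExt, fun _ => ?_⟩,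
    ⟨CleftDim.extDim_le_extDim_trivSqZeroExt, ?_⟩, CleftDim.derDim_le_derDim_trivSqZeroExt, ?_⟩
  · exact ENat.le_sub_of_add_le_right ENat.one_ne_top
      (CleftDim.IT_trivSqZeroExt_add_one_le (Nat.one_le_iff_ne_zero.1 hn) hM)
  · exact CleftDim.le_min_two_mul_add_one_sub_one hn hM CleftDim.extDim_trivSqZeroExt_le
      CleftDim.extDim_trivSqZeroExt_add_one_le
  · exact CleftDim.le_min_two_mul_add_one_sub_one hn hM CleftDim.derDim_trivSqZeroExt_le
      CleftDim.derDim_trivSqZeroExt_add_one_le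

theorem mainTheorem8 {R : Type w} {Γ M : Type u}
    [CommRing R] [IsNoetherianRing R] [Ring Γ] [Algebra R Γ] [Module.Finite R Γ]
    [AddCommGroup M] [Module Γ M] [Module Γᵐᵒᵖ M] [SMulCommClass Γ Γᵐᵒᵖ M]
    [Module R M] [IsScalarTower R Γ M] [IsScalarTower R Γᵐᵒᵖ M] [Module.Finite R M]
    (n : ℕ) (hn : 1 ≤ n) (hM : Subsingleton (CleftDim.tensorPower Γ M n).carrier) :
    haveI : IsNoetherianRing Γᵐᵒᵖ := CleftDim.isNoetherianRing_op R Γ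
    haveI : Module.Finite R (TrivSqZeroExt Γ M) := CleftDim.finite_trivSqZeroExt R Γ M
    haveI : IsNoetherianRing (TrivSqZeroExt Γ M)ᵐᵒᵖ :=
      CleftDim.isNoetherianRing_op R (TrivSqZeroExt Γ M)
    ((Module.Projective Γ M ∧ Module.Projective Γᵐᵒᵖ M) →
      CleftDim.IT Γ ≤ CleftDim.IT (TrivSqZeroExt Γ M) ∧
      CleftDim.IT (TrivSqZeroExt Γ M) ≤ n * (CleftDim.IT Γ + 1) - 1) ∧
    (Module.Projective Γᵐᵒᵖ M →
      CleftDim.extDim Γ ≤ CleftDim.extDim (TrivSqZeroExt Γ M) ∧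
      CleftDim.extDim (TrivSqZeroExt Γ M) ≤ n * (CleftDim.extDim Γ + 1) - 1) ∧
    (CleftDim.IsLeftPerfect Γ M →
      CleftDim.derDim Γ ≤ CleftDim.derDim (TrivSqZeroExt Γ M) ∧
      CleftDim.derDim (TrivSqZeroExt Γ M) ≤ n * (CleftDim.derDim Γ + 1) - 1) := by
  have : Module.Finite Γᵐᵒᵖ M := Module.Finite.of_restrictScalars_finite R Γᵐᵒᵖ M
  have : IsNoetherianRing Γᵐᵒᵖ := CleftDim.isNoetherianRing_op R Γ
  have mul_le (x : ℕ∞) : (min n 2 : ℕ) * (x + 1) - 1 ≤ n * (x + 1) - 1 := by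
    gcongr
    exact min_le_left n 2
  obtain ⟨⟨hIT, hIT'⟩, ⟨hext, hext'⟩, hder, hder'⟩ := mainTheorem8_general n hn hM
  exact ⟨fun ⟨hl, hr⟩ => ⟨hIT hr, hIT' hl⟩, fun _ => ⟨hext, hext'.trans (mul_le _)⟩,
    fun _ => ⟨hder, hder'.trans (mul_le _)⟩⟩
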